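/- **Setting.** There are $n$ bidders and $k$ types of goods with supply $s$ each; bidder $i$ has a valuation $v_i=(v_{ij})_{j\le k}\in[0,1]^k$. Let $0<\alpha\le 1$, $0<\rho\le1$, $\varepsilon>0$, $\gamma>0$, and put $$T=\Big\lceil \frac{8}{\alpha\rho}\Big\rceil,\quad \varepsilon'=\frac{\varepsilon}{2T},\quad E=\frac{2\sqrt2}{\varepsilon'}(\log_2 nT)^{5/2}\ln\frac{4k}{\gamma},\quad m=2E+1 .$$ **Counters.** $\mathbf{Counter}(\varepsilon',nT)$ is the binary mechanism: on a bit stream $\sigma(1),\sigma(2),\dots$ of length at most $nT$, at each time $e$ with least nonzero binary digit $i$ it forms the noisy partial sum $\sum_{u=e-2^i+1}^{e}\sigma(u)+Z_e$ with fresh independent noise $Z_e\sim\mathrm{Lap}(\log_2(nT)/\varepsilon')$, where $\mathrm{Lap}(b)$ has density $e^{-|x|/b}/(2b)$. Its reading at time $t$ is the sum of the noisy partial sums of the dyadic intervals that decompose $\{1,\dots,t\}$ according to the binary expansion of $t$. **Algorithm $\mathrm{PMatch}(\alpha,\rho,\varepsilon)$.** There are independent counters $\mathrm{counter}(0),\dots,\mathrm{counter}(k)$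 of this kind. Initially $p_j=c_j=0$ for all goods $j$, and $\mu(i)=\emptyset$, $d_i=0$ for all bidders $i$. Repeat the following round $T$ times. 1. *Propose.* For each bidder $i$ in a fixed order: if $\mu(i)=\emptyset$, let $j$ be a maximizer of $v_{ij}-p_j$, with ties broken by an arbitrary fixed rule depending only on $i$, $v_i$ and $p$. If $v_{ij}-p_j\le0$, set $\mu(i)=\perp$ and call $\mathbf{Bid}(\mathbf 0)$; otherwise set $\mu(i)=j$, $d_i=c_j$ and call $\mathbf{Bid}(\mathbf e_j)$. If $\mu(i)\ne\emptyset$, call $\mathbf{Bid}(\mathbf 0)$. Here $\mathbf{Bid}(\mathbf b)$ does the following for every good $j$: it feeds $b_j$ to $\mathrm{counter}(j)$, sets $c_j$ to the new reading, and increases $p_j$ by $\alpha$ if $c_j\ge(p_j/\alpha+1)(s-m)$. 2. *CountUnsatisfied.* For each bidder $i$ in order: if $\mu(i)$ is a good and $c_{\mu(i)}-d_i\ge s-m$, feed $1$ to $\mathrm{counter}(0)$ and set $\mu(i)=\emptyset$; otherwise feed $0$. If the reading of $\mathrm{counter}(0)$ has increased by less than $\rho n-2E$ during the round, halt. At the end,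 every bidder with $\mu(i)=\emptyset$ gets $\mu(i)=\perp$. The output is the price vector $p$, which everybody sees, and the allocation $\mu$, of which bidder $i$ gets $\mu(i)$. **Theorem.** (a) $\mathrm{PMatch}(\alpha,\rho,\varepsilon)$ is $\varepsilon$-joint differentially private with respect to one bidder changing all of her valuations: for every bidder $i$, all valuation profiles $v,v'$ with $v_j=v'_j$ for all $j\ne i$, and every measurable set $S$ of possible outputs $(p,\mu(j))_{j\ne i}$ of the other bidders, $$\Pr\big[(p,\mu(j))_{j\neq i}(v)\in S\big]\le e^{\varepsilon}\,\Pr\big[(p,\mu(j))_{j\neq i}(v')\in S\big].$$ (b) The released trajectory is $\varepsilon$-differentially private. It consists of the noisy bid counts $c$ and the prices $p$ after every call of $\mathbf{Bid}$ until the algorithm stops, together with all readings of $\mathrm{counter}(0)$ in the rounds $1,\dots,T-1$. That is, if $\tau(v)$ denotes this trajectory on the profile $v$, then $\Pr[\tau(v)\in S]\le e^{\varepsilon}\Pr[\tau(v')\in S]$ for all $v,v'$ that differ in the valuations of one bidder only and every measurable set $S$. -/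

import Mathlib

open MeasureTheory

noncomputable section

/-! ### Differential privacy and joint differential privacy -/

/-- `D` and `D'` differ at most in the data of agent `i`. -/
def AreNeighborsAt {n : ℕ} {C : Type*} (i : Fin n) (D D' : Fin n → C) : Prop :=
  ∀ j, j ≠ i → D j = D' j

/-- A randomized algorithm is given by its random coins (a sample space `Ω` with law `P`) and,
for each database, its output as a function of the coins.  It is `ε`-differentially private if
`Pr[M(D) ∈ S] ≤ exp ε * Pr[M(D') ∈ S]` for all neighboring databases and all events `S`. -/
def IsDifferentiallyPrivate {n : ℕ} {C Ω R : Type*} [MeasurableSpace Ω] [MeasurableSpace R]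
    (ε : ℝ) (P : Measure Ω) (M : (Fin n → C) → Ω → R) : Prop :=
  ∀ (i : Fin n) (D D' : Fin n → C), AreNeighborsAt i D D' →
    ∀ S : Set R, MeasurableSet S →
      P {ω | M D ω ∈ S} ≤ ENNReal.ofReal (Real.exp ε) * P {ω | M D' ω ∈ S}

/-- `ε`-joint differential privacy of an algorithm with one output per agent: the joint
distribution of the outputs of all the agents other than `i` is `ε`-private in the data of `i`. -/
def IsJointDifferentiallyPrivate {n : ℕ} {C Ω A : Type*} [MeasurableSpace Ω] [MeasurableSpace A]
    (ε : ℝ) (P : Measure Ω) (M : (Fin n → C) → Ω → (Fin n → A)) : Prop :=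
  ∀ (i : Fin n) (D D' : Fin n → C), AreNeighborsAt i D D' →
    ∀ S : Set ({j : Fin n // j ≠ i} → A), MeasurableSet S →
      P {ω | (fun j : {j : Fin n // j ≠ i} => M D ω j) ∈ S} ≤
        ENNReal.ofReal (Real.exp ε) * P {ω | (fun j : {j : Fin n // j ≠ i} => M D' ω j) ∈ S}

/-! ### The binary mechanism -/

/-- The Laplace distribution `Lap(b)`, with density `exp (-|x| / b) / (2 b)` (variance `2 b²`). -/
def laplaceMeasure (b : ℝ) : Measure ℝ :=
  volume.withDensity fun x => ENNReal.ofReal (Real.exp (-|x| / b) / (2 * b))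

/-- The count released by the binary mechanism at time `t` on the stream `σ(1), σ(2), …`.
For every nonzero binary digit `i` of `t`, let `e = ⌊t / 2 ^ i⌋ * 2 ^ i`, i.e. `t` with its digits
below `i` cleared; the mechanism adds up the noisy partial sums
`∑ [e - 2 ^ i + 1, e] + z e`.  A partial sum is created once, at the time `e` at which its interval
ends (exactly one at each time, `i` being the least nonzero digit of `e`); its noise `z e` is drawn
then and is reused at all later times. -/
def binaryMechanism (σ z : ℕ → ℝ) (t : ℕ) : ℝ :=
  ∑ i ∈ (Finset.range t.size).filter (fun i => t.testBit i = true),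
    ((∑ u ∈ Finset.Ioc (t / 2 ^ i * 2 ^ i - 2 ^ i) (t / 2 ^ i * 2 ^ i), σ u)
      + z (t / 2 ^ i * 2 ^ i))

/-! ### The algorithm PMatch -/

namespace PMatch

/-- A matching market with `n` bidders, `k` types of goods and supply `s` of each type, and the
parameters `α`, `ρ`, `ε` and the failure probability `γ` of the algorithm. -/
structure Params where
  n : ℕ
  k : ℕ
  s : ℕ
  α : ℝ
  ρ : ℝ
  ε : ℝ
  γ : ℝ

variable (P : Params)

/-- The number `T = 8 / (α ρ)` of proposal rounds, rounded up. -/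
def Params.T : ℕ := ⌈8 / (P.α * P.ρ)⌉₊

/-- The length `n T` of the input streams of the counters. -/
def Params.horizon : ℕ := P.n * P.T

/-- The privacy parameter `ε' = ε / (2 T)` of each counter. -/
def Params.ε' : ℝ := P.ε / (2 * P.T)

/-- The error bound `E` for the counters. -/
def Params.E : ℝ :=
  2 * √2 / P.ε' * Real.logb 2 P.horizon ^ (5 / 2 : ℝ) * Real.log (4 * P.k / P.γ)

/-- The reserved supply `m = 2 E + 1`. -/
def Params.m : ℝ := 2 * P.E + 1

/-- The unit demand valuations: a value in `[0, 1]` for every type of good. -/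
abbrev Valuation : Type := Fin P.k → Set.Icc (0 : ℝ) 1

/-- The counters: `none` is `counter(0)`, which counts the unsatisfied bidders, and `some j` is the
counter of the bids on good `j`. -/
abbrev CounterId : Type := Option (Fin P.k)

/-- The random coins: each counter draws one noise variable at each of its `n T` steps. -/
abbrev Noise : Type := CounterId P → Fin P.horizon → ℝ

/-- All noise is independent, with law `Lap(log₂(n T) / ε')`. -/
def noiseLaw : Measure (Noise P) :=
  Measure.pi fun _ => Measure.pi fun _ => laplaceMeasure (Real.logb 2 P.horizon / P.ε')

/-- The current reading of counter `c = Counter(ε', n T)` after it has been fed the bits `l`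
(oldest bit first). -/
def reading (ω : Noise P) (c : CounterId P) (l : List ℕ) : ℝ :=
  binaryMechanism (fun t => (l.getD (t - 1) 0 : ℕ))
    (fun t => if h : t - 1 < P.horizon then ω c ⟨t - 1, h⟩ else 0) l.length

/-- The value of `μ(i)`: `∅` (wants to bid), `⊥` (the dummy good), or a good. -/
inductive Status (k : ℕ) : Type
  | unassigned : Status k
  | dummy : Status k
  | good (j : Fin k) : Status k

/-- The state of the algorithm. -/
structure State where
  /-- the bits fed so far to each counter -/
  stream : CounterId P → List ℕ
  /-- the counts `c_j` -/
  count : Fin P.k → ℝ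
  /-- how often the price of each good has been increased (by `α` each time) -/
  increments : Fin P.k → ℕ
  /-- the tentative assignment `μ` -/
  status : Fin P.n → Status P.k
  /-- the saved counts `d_i` -/
  saved : Fin P.n → ℝ
  /-- whether the algorithm has halted early -/
  halted : Bool
  /-- the counts `c` and the prices `p` after every call of `Bid` so far -/
  bidLog : List ((Fin P.k → ℝ) × (Fin P.k → ℝ))
  /-- the readings of `counter(0)` after every bit fed to it so far -/
  unsatisfiedLog : List ℝ

variable {P}

/-- The price `p_j`. -/
def State.price (st : State P) (j : Fin P.k) : ℝ := P.α * st.increments j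

variable (P) in
def initialState : State P where
  stream := fun _ => []
  count := fun _ => 0
  increments := fun _ => 0
  status := fun _ => .unassigned
  saved := fun _ => 0
  halted := false
  bidLog := []
  unsatisfiedLog := []

open Classical in
/-- `Bid` with bid vector `b`. -/
def bid (ω : Noise P) (b : Fin P.k → ℕ) (st : State P) : State P :=
  let count' : Fin P.k → ℝ := fun j => reading P ω (some j) (st.stream (some j) ++ [b j])
  let increments' : Fin P.k → ℕ := fun j =>
    if (st.price j / P.α + 1) * (P.s - P.m) ≤ count' j then st.increments j + 1
    else st.increments j
  { st with
    stream := fun c => match c with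
      | none => st.stream none
      | some j => st.stream (some j) ++ [b j]
    count := count'
    increments := increments'
    bidLog := st.bidLog ++ [(count', fun j => P.α * increments' j)] }

/-- A rule by which the bidders choose the good to bid on, from their own valuation and the current
prices. -/
abbrev ChoiceRule (P : Params) : Type :=
  Fin P.n → Valuation P → (Fin P.k → ℝ) → Fin P.k

/-- The chosen good maximizes `v_j - p_j`; how ties are broken is left open. -/
def ChoiceRule.IsArgmax (pick : ChoiceRule P) : Prop :=
  ∀ (i : Fin P.n) (v : Valuation P) (p : Fin P.k → ℝ) (j : Fin P.k),
    (v j : ℝ) - p j ≤ (v (pick i v p) : ℝ) - p (pick i v p)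

open Classical in
/-- The turn of bidder `i` in `Propose`. -/
def proposeBidder (pick : ChoiceRule P) (D : Fin P.n → Valuation P) (ω : Noise P)
    (st : State P) (i : Fin P.n) : State P :=
  match st.status i with
  | .unassigned =>
    let j := pick i (D i) st.price
    if (D i j : ℝ) - st.price j ≤ 0 then
      bid ω 0 { st with status := Function.update st.status i .dummy }
    else
      bid ω (Pi.single j 1)
        { st with
          status := Function.update st.status i (.good j)
          saved := Function.update st.saved i (st.count j) }
  | .dummy => bid ω 0 st
  | .good _ => bid ω 0 st

/-- Feed the bit `b` to `counter(0)`. -/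
def report (ω : Noise P) (b : ℕ) (st : State P) : State P :=
  { st with
    stream := Function.update st.stream none (st.stream none ++ [b])
    unsatisfiedLog := st.unsatisfiedLog ++ [reading P ω none (st.stream none ++ [b])] }

open Classical in
/-- The turn of bidder `i` in `CountUnsatisfied`. -/
def countBidder (ω : Noise P) (st : State P) (i : Fin P.n) : State P :=
  if ∃ j, st.status i = .good j ∧ (P.s - P.m : ℝ) ≤ st.count j - st.saved i then
    report ω 1 { st with status := Function.update st.status i .unassigned }
  else report ω 0 st

/-- Halting: every unassigned bidder gets the dummy good. -/
def halt (st : State P) : State P :=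
  { st with
    halted := true
    status := fun i => match st.status i with
      | .unassigned => .dummy
      | .dummy => .dummy
      | .good j => .good j }

open Classical in
/-- One round: `Propose`, `CountUnsatisfied` and the test of the halting condition; nothing happens
any more once the algorithm has halted. -/
def round (pick : ChoiceRule P) (D : Fin P.n → Valuation P) (ω : Noise P) (st : State P) :
    State P :=
  if st.halted = true then st else
    let st₁ := (List.finRange P.n).foldl (proposeBidder pick D ω) st
    let st₂ := (List.finRange P.n).foldl (countBidder ω) st₁
    if reading P ω none (st₂.stream none) - reading P ω none (st.stream none)
        < P.ρ * P.n - 2 * P.E then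
      halt st₂
    else st₂

/-- The final state, after at most `T` rounds. -/
def finalState (pick : ChoiceRule P) (D : Fin P.n → Valuation P) (ω : Noise P) : State P :=
  (round pick D ω)^[P.T] (initialState P)

/-- Allocations are discrete. -/
instance (k : ℕ) : MeasurableSpace (Option (Fin k)) := ⊤

/-- The good that bidder `i` gets; `none` is the dummy good `⊥`, to which all unmatched bidders are
considered to be matched. -/
def State.allocation (st : State P) (i : Fin P.n) : Option (Fin P.k) :=
  match st.status i with
  | .unassigned => none
  | .dummy => none
  | .good j => some j

/-- The output of `PMatch`: every bidder gets the (public) final prices and her own good. -/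
def output (pick : ChoiceRule P) (D : Fin P.n → Valuation P) (ω : Noise P) :
    Fin P.n → (Fin P.k → ℝ) × Option (Fin P.k) :=
  fun i => ((finalState pick D ω).price, (finalState pick D ω).allocation i)

/-- The trajectory released during the run: the number of calls of `Bid` (which tells when the
algorithm halted), the noisy bid counts and the prices after every such call, and the noisy count of
unsatisfied bidders after every bit fed to `counter(0)` in the rounds `1, …, T - 1`.  (In round
`T`, the last one, no decision depends on `counter(0)` any more, and it is not released.)
The sequences are extended by `0` beyond their end. -/
def trajectory (pick : ChoiceRule P) (D : Fin P.n → Valuation P) (ω : Noise P) :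
    ℕ × (ℕ → (Fin P.k → ℝ) × (Fin P.k → ℝ)) × (ℕ → ℝ) :=
  let st := finalState pick D ω
  (st.bidLog.length, fun t => st.bidLog.getD t 0,
    fun t => (st.unsatisfiedLog.take (P.n * (P.T - 1))).getD t 0)

end PMatch

end

/-! Fix the noisy partial sums `s` of all counters. They determine all readings, hence prices,
statuses, saved counts and every bit fed to a counter. So the run with coins `ω` amounts to an
equation "`s` = `ω` + (true partial sums of the bits determined by `s`)". It has a unique solution,
because a bid depends only on bid counters at strictly earlier times and `counter(0)` never
influences a bit. Early halting only truncates this run, so all of it is first described as if it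
never halted.

Conversely `ω` can be recovered from `s` and the data at every released position. If the data
changes from `D` to `D'`, the coins must move by `noiseShift`, an integer vector depending on `s`
alone, for the same `s` to come out (`partialSums_add_noiseShift`). On the part of the sample space
where this vector is constant, the change of coins is a translation, and a translation by `δ` costs
a Laplace law a factor of at most `exp (‖δ‖₁ / b)`. The shift takes countably many values, so these
parts add up.

It remains to show that the shift has ℓ¹ norm at most `2 T log₂ (n T)`, as `b = log₂ (n T) / ε'` and
`2 T ε' = ε`. Only the bits of the changed bidder matter, and she bids in round `r + 1` only if she
reported in round `r`. So the changed reports of one round and the changed bids of the next number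
at most two together, and the first bids at most two more; the last reports are not released. This
gives `2 T` bit changes, each seen by about `log₂ (n T)` partial sums. The exact bound needs care at
position `0`, which lies in one block too many (`sum_blockCount_le`).

The trajectory and the others' outputs are functions of `s`. The one decision outside `s` is the
halting test of round `T`; its only effect is to replace `∅` by `⊥`, which changes neither. -/

noncomputable section

/-! ### The dyadic intervals of the binary mechanism -/

/-- The positions (counted from `0`) of the partial sum that the binary mechanism creates after
`e + 1` steps. -/
def dyadicBlock (e : ℕ) : Finset ℕ :=
  Finset.Ico (e + 1 - 2 ^ padicValNat 2 (e + 1)) (e + 1)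

/-- A set digit `i` makes `t / 2 ^ i` odd. Hence the block that a reading uses for this digit is the
very block created at its end time. -/
theorem padicValNat_div_mul_of_testBit {t i : ℕ} (h : t.testBit i = true) :
    padicValNat 2 (t / 2 ^ i * 2 ^ i) = i := by
  have hodd : t / 2 ^ i % 2 = 1 := by
    rw [Nat.testBit_eq_decide_div_mod_eq] at h
    simpa using h
  have h0 : t / 2 ^ i ≠ 0 := by intro h; simp [h] at hodd
  rw [padicValNat.mul h0 (by positivity), padicValNat.prime_pow,
    padicValNat.eq_zero_of_not_dvd (by omega), zero_add]

theorem two_pow_le_div_mul_of_testBit {t i : ℕ} (h : t.testBit i = true) :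
    2 ^ i ≤ t / 2 ^ i * 2 ^ i := by
  have hodd : t / 2 ^ i % 2 = 1 := by
    rw [Nat.testBit_eq_decide_div_mod_eq] at h
    simpa using h
  exact Nat.le_mul_of_pos_left _ (Nat.pos_of_ne_zero fun h0 => by simp [h0] at hodd)

/-- A reading of the binary mechanism is a sum of noisy partial sums. -/
theorem binaryMechanism_eq_of_partialSums {σ z y : ℕ → ℝ} {t : ℕ}
    (h : ∀ e < t, y (e + 1) = z (e + 1) + ∑ u ∈ dyadicBlock e, σ (u + 1)) :
    binaryMechanism σ z t = binaryMechanism 0 y t := by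
  unfold binaryMechanism
  refine Finset.sum_congr rfl fun i hi => ?_
  have hb : t.testBit i = true := (Finset.mem_filter.1 hi).2
  have hpos := two_pow_le_div_mul_of_testBit hb
  have hval := padicValNat_div_mul_of_testBit hb
  have hle : t / 2 ^ i * 2 ^ i ≤ t := Nat.div_mul_le_self _ _
  have h2 : 0 < 2 ^ i := by positivity
  set e := t / 2 ^ i * 2 ^ i
  obtain ⟨e', he⟩ : ∃ e', e = e' + 1 := ⟨e - 1, by omega⟩
  rw [he] at hval
  rw [he, h e' (by omega), dyadicBlock, hval]
  have : ∑ u ∈ Finset.Ioc (e' + 1 - 2 ^ i) (e' + 1), σ u =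
      ∑ u ∈ Finset.Ico (e' + 1 - 2 ^ i) (e' + 1), σ (u + 1) := by
    rw [Finset.sum_Ico_add' σ _ _ 1]
    refine Finset.sum_congr ?_ fun _ _ => rfl
    ext u
    simp only [Finset.mem_Ioc, Finset.mem_Ico]
    omega
  simp only [Pi.zero_apply, Finset.sum_const_zero, zero_add]
  rw [this, add_comm]

/-- With the zero stream, the second argument plays the role of the noisy partial sums. A reading at
time `t` only uses those created up to then, which is the source of causality. -/
theorem binaryMechanism_congr {y y' : ℕ → ℝ} {t : ℕ} (h : ∀ e < t, y (e + 1) = y' (e + 1)) :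
    binaryMechanism 0 y t = binaryMechanism 0 y' t := by
  rw [binaryMechanism_eq_of_partialSums (z := y) (y := y')]
  intro e he
  simp [h e he]

namespace PMatch

variable {P : Params}

/-! ### The run without early halting, as a function of the noisy partial sums -/

/-- The reading of counter `c` after `t` steps, computed from the noisy partial sums `s`. -/
def tally (s : Noise P) (c : CounterId P) (t : ℕ) : ℝ :=
  binaryMechanism 0 (fun t => if h : t - 1 < P.horizon then s c ⟨t - 1, h⟩ else 0) t

open Classical in
/-- The number of price increments after `t` calls of `Bid`. -/
def incrementsAt (s : Noise P) : ℕ → Fin P.k → ℕ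
  | 0 => fun _ => 0
  | t + 1 => fun j =>
    if (P.α * incrementsAt s t j / P.α + 1) * (P.s - P.m) ≤ tally s (some j) (t + 1) then
      incrementsAt s t j + 1
    else incrementsAt s t j

/-- The data of a single bidder: her status, and the good and time of her last bid. -/
abbrev BidderState (P : Params) : Type := Status P.k × Option (Fin P.k × ℕ)

/-- The saved count `d_i`. -/
def savedCount (s : Noise P) : Option (Fin P.k × ℕ) → ℝ
  | none => 0
  | some (j, t) => tally s (some j) t

open Classical in
/-- The turn in `Propose` of bidder `b` with valuation `v`, at the time `t` and with the
prices given by the increments `q`. -/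
def proposeAt (pick : ChoiceRule P) (b : Fin P.n) (v : Valuation P) (q : Fin P.k → ℕ) (t : ℕ) :
    BidderState P → BidderState P
  | (.unassigned, d) =>
    if (v (pick b v fun j => P.α * q j) : ℝ) - P.α * q (pick b v fun j => P.α * q j) ≤ 0 then
      (.dummy, d)
    else (.good (pick b v fun j => P.α * q j), some (pick b v fun j => P.α * q j, t))
  | (.dummy, d) => (.dummy, d)
  | (.good j, d) => (.good j, d)

/-- A bidder is unsatisfied at the end of round `r`. -/
def Unsatisfied (s : Noise P) (r : ℕ) (x : BidderState P) : Prop :=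
  ∃ j, x.1 = .good j ∧
    (P.s - P.m : ℝ) ≤ tally s (some j) ((r + 1) * P.n) - savedCount s x.2

open Classical in
/-- The turn of a bidder in `CountUnsatisfied`, in round `r`. -/
def releaseAt (s : Noise P) (r : ℕ) (x : BidderState P) : BidderState P :=
  if Unsatisfied s r x then (.unassigned, x.2) else x

/-- The data of bidder `b` before round `r`. -/
def bidderAt (pick : ChoiceRule P) (b : Fin P.n) (v : Valuation P) (s : Noise P) :
    ℕ → BidderState P
  | 0 => (.unassigned, none)
  | r + 1 => releaseAt s r
      (proposeAt pick b v (incrementsAt s (r * P.n + b)) (r * P.n + b) (bidderAt pick b v s r))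

/-- The data of bidder `b` after her proposal in round `r`. -/
def proposedAt (pick : ChoiceRule P) (b : Fin P.n) (v : Valuation P) (s : Noise P) (r : ℕ) :
    BidderState P :=
  proposeAt pick b v (incrementsAt s (r * P.n + b)) (r * P.n + b) (bidderAt pick b v s r)

open Classical in
/-- The bit that bidder `b` feeds to counter `c` in round `r`. -/
def bidderBit (pick : ChoiceRule P) (b : Fin P.n) (v : Valuation P) (s : Noise P) (r : ℕ) :
    CounterId P → ℕ
  | none => if Unsatisfied s r (proposedAt pick b v s r) then 1 else 0
  | some j =>
    if (bidderAt pick b v s r).1 = .unassigned ∧ (proposedAt pick b v s r).1 = .good j then 1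
    else 0

/-- The bit fed to counter `c` at the time `u`, counted from `0`. -/
def bitAt (pick : ChoiceRule P) (D : Fin P.n → Valuation P) (s : Noise P) (c : CounterId P)
    (u : ℕ) : ℕ :=
  if h : 0 < P.n then
    bidderBit pick ⟨u % P.n, Nat.mod_lt _ h⟩ (D ⟨u % P.n, Nat.mod_lt _ h⟩) s (u / P.n) c
  else 0

/-- The partial sums that are released: `counter(0)` is not released in the last round. -/
def IsReleased (P : Params) : CounterId P → ℕ → Prop
  | none, e => e < P.n * (P.T - 1)
  | some _, _ => True

open Classical in
/-- The noisy partial sums that the bits determined by `s` lead to. -/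
def feedback (pick : ChoiceRule P) (D : Fin P.n → Valuation P) (ω s : Noise P) : Noise P :=
  fun c e =>
    if IsReleased P c e then ω c e + ∑ u ∈ dyadicBlock e, (bitAt pick D s c u : ℝ) else 0

/-- The noisy partial sums of the run with the coins `ω`. -/
def partialSums (pick : ChoiceRule P) (D : Fin P.n → Valuation P) (ω : Noise P) : Noise P :=
  (feedback pick D ω)^[P.horizon + 1] 0

/-! ### The noisy partial sums are the unique fixed point of the feedback -/

/-- The partial sums of the bid counters agree up to time `t`. -/
def AgreeBefore (t : ℕ) (s s' : Noise P) : Prop :=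
  ∀ (j : Fin P.k) (e : Fin P.horizon), (e : ℕ) < t → s (some j) e = s' (some j) e

variable {t : ℕ} {s s' : Noise P}

theorem AgreeBefore.mono {t' : ℕ} (h : AgreeBefore t s s') (ht : t' ≤ t) :
    AgreeBefore t' s s' := fun j e he => h j e (he.trans_le ht)

theorem AgreeBefore.of_horizon (h : AgreeBefore P.horizon s s') (t : ℕ) : AgreeBefore t s s' :=
  fun j e _ => h j e e.2

theorem AgreeBefore.tally_eq (h : AgreeBefore t s s') (j : Fin P.k) :
    tally s (some j) t = tally s' (some j) t := by
  refine binaryMechanism_congr fun e he => ?_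
  simp only [add_tsub_cancel_right]
  split_ifs with hN
  · exact h j _ he
  · rfl

theorem AgreeBefore.incrementsAt_eq (h : AgreeBefore t s s') :
    incrementsAt s t = incrementsAt s' t := by
  induction t with
  | zero => rfl
  | succ t ih =>
    funext j
    simp only [incrementsAt, ih (h.mono t.le_succ), h.tally_eq]

theorem proposeAt_snd_time {pick : ChoiceRule P} {b : Fin P.n} {v : Valuation P}
    {q : Fin P.k → ℕ} {t : ℕ} {x : BidderState P} (hx : ∀ y ∈ x.2, y.2 ≤ t) :
    ∀ y ∈ (proposeAt pick b v q t x).2, y.2 ≤ t := by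
  rcases x with ⟨_ | _ | _, d⟩
  · simp only [proposeAt]
    split_ifs
    · exact hx
    · intro y hy
      simp only [Option.mem_def, Option.some.injEq] at hy
      simp [← hy]
  · exact hx
  · exact hx

theorem releaseAt_snd (r : ℕ) (x : BidderState P) : (releaseAt s r x).2 = x.2 := by
  unfold releaseAt
  split_ifs <;> rfl

theorem bidderAt_snd_time (pick : ChoiceRule P) (b : Fin P.n) (v : Valuation P) (s : Noise P)
    (r : ℕ) : ∀ y ∈ (bidderAt pick b v s r).2, y.2 ≤ r * P.n := by
  induction r with
  | zero => simp [bidderAt]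
  | succ r ih =>
    intro y hy
    simp only [bidderAt, releaseAt_snd] at hy
    have := proposeAt_snd_time (t := r * P.n + b)
      (fun y hy => (ih y hy).trans (Nat.le_add_right _ _)) y hy
    have hb := b.2
    rw [add_mul]
    omega

theorem proposedAt_snd_time (pick : ChoiceRule P) (b : Fin P.n) (v : Valuation P) (s : Noise P)
    (r : ℕ) : ∀ y ∈ (proposedAt pick b v s r).2, y.2 ≤ r * P.n + b :=
  proposeAt_snd_time fun y hy =>
    (bidderAt_snd_time pick b v s r y hy).trans (Nat.le_add_right _ _)

theorem AgreeBefore.savedCount_eq (h : AgreeBefore t s s') {d : Option (Fin P.k × ℕ)}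
    (hd : ∀ y ∈ d, y.2 ≤ t) : savedCount s d = savedCount s' d := by
  rcases d with _ | ⟨j, u⟩
  · rfl
  · exact (h.mono (hd (j, u) rfl)).tally_eq j

theorem AgreeBefore.unsatisfied_iff {r : ℕ} (h : AgreeBefore ((r + 1) * P.n) s s')
    {x : BidderState P} (hx : ∀ y ∈ x.2, y.2 ≤ (r + 1) * P.n) :
    Unsatisfied s r x ↔ Unsatisfied s' r x := by
  simp only [Unsatisfied, h.tally_eq, h.savedCount_eq hx]

/-- Statuses change only through prices and bid counts, never through `counter(0)`, so agreement of
the bid counters is enough. -/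
theorem AgreeBefore.bidderAt_eq {r : ℕ} (h : AgreeBefore (r * P.n) s s') (pick : ChoiceRule P)
    (b : Fin P.n) (v : Valuation P) : bidderAt pick b v s r = bidderAt pick b v s' r := by
  induction r with
  | zero => rfl
  | succ r ih =>
    have hb : r * P.n + b ≤ (r + 1) * P.n := by rw [add_mul]; have := b.2; omega
    have hx := fun y hy => (proposedAt_snd_time pick b v s r y hy).trans hb
    have hinc := (h.mono hb).incrementsAt_eq
    have hr := ih (h.mono (by omega))
    unfold proposedAt at hx
    rw [bidderAt, bidderAt, ← hr, ← hinc]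
    rw [releaseAt, releaseAt, propext (h.unsatisfied_iff hx)]

theorem AgreeBefore.proposedAt_eq {r : ℕ} {b : Fin P.n} (h : AgreeBefore (r * P.n + b) s s')
    (pick : ChoiceRule P) (v : Valuation P) :
    proposedAt pick b v s r = proposedAt pick b v s' r := by
  rw [proposedAt, proposedAt, (h.mono (Nat.le_add_right _ _)).bidderAt_eq, h.incrementsAt_eq]

/-- Strict causality: the bid at position `t` is made before the partial sum number `t` exists. -/
theorem AgreeBefore.bitAt_some_eq (h : AgreeBefore t s s') (pick : ChoiceRule P)
    (D : Fin P.n → Valuation P) (j : Fin P.k) :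
    bitAt pick D s (some j) t = bitAt pick D s' (some j) t := by
  unfold bitAt
  split_ifs with hn
  · have ht : t / P.n * P.n + t % P.n = t := Nat.div_add_mod' _ _
    set b : Fin P.n := ⟨t % P.n, Nat.mod_lt _ hn⟩ with hb
    have h' : AgreeBefore (t / P.n * P.n + b) s s' := by rwa [hb, ht]
    rw [bidderBit, bidderBit, h'.proposedAt_eq, (h'.mono (Nat.le_add_right _ _)).bidderAt_eq]
  · rfl

/-- Reports look at the counts at the end of their round, later than their own position in the
stream. Agreement up to the horizon covers them. -/
theorem AgreeBefore.bitAt_eq (h : AgreeBefore P.horizon s s') (pick : ChoiceRule P)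
    (D : Fin P.n → Valuation P) (c : CounterId P) (u : ℕ) :
    bitAt pick D s c u = bitAt pick D s' c u := by
  rcases c with _ | j
  · unfold bitAt
    split_ifs with hn
    · set b : Fin P.n := ⟨u % P.n, Nat.mod_lt _ hn⟩
      have hb : u / P.n * P.n + b ≤ (u / P.n + 1) * P.n := by rw [add_mul]; have := b.2; omega
      rw [bidderBit, bidderBit, ← (h.of_horizon _).proposedAt_eq,
        propext ((h.of_horizon _).unsatisfied_iff
          fun y hy => (proposedAt_snd_time pick b _ s _ y hy).trans hb)]
    · rfl
  · exact (h.of_horizon u).bitAt_some_eq pick D j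

/-- The block of `e` ends at position `e`, so with `e ≤ t` it only involves bids that already agree.
Each feedback step thus fixes one more time. -/
theorem AgreeBefore.feedback (h : AgreeBefore t s s') (pick : ChoiceRule P)
    (D : Fin P.n → Valuation P) (ω : Noise P) :
    AgreeBefore (t + 1) (feedback pick D ω s) (feedback pick D ω s') := by
  intro j e he
  have : ∀ u ∈ dyadicBlock e,
      (bitAt pick D s (some j) u : ℝ) = bitAt pick D s' (some j) u := by
    intro u hu
    rw [dyadicBlock, Finset.mem_Ico] at hu
    rw [(h.mono (show u ≤ t by omega)).bitAt_some_eq]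
  simp only [PMatch.feedback, Finset.sum_congr rfl this]

theorem AgreeBefore.feedback_eq (h : AgreeBefore P.horizon s s') (pick : ChoiceRule P)
    (D : Fin P.n → Valuation P) (ω : Noise P) :
    PMatch.feedback pick D ω s = PMatch.feedback pick D ω s' := by
  funext c e
  simp only [PMatch.feedback, h.bitAt_eq]

theorem agreeBefore_iterate_feedback (pick : ChoiceRule P) (D : Fin P.n → Valuation P)
    (ω s s' : Noise P) (t : ℕ) :
    AgreeBefore t ((feedback pick D ω)^[t] s) ((feedback pick D ω)^[t] s') := by
  induction t with
  | zero => intro j e he; omega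
  | succ t ih =>
    rw [Function.iterate_succ_apply', Function.iterate_succ_apply']
    exact ih.feedback pick D ω

/-- After `P.horizon` steps the bid counters no longer depend on the starting point, and one further
step settles `counter(0)`. Comparing the starting points `0` and `feedback 0` gives the fixed point.
-/
theorem feedback_partialSums (pick : ChoiceRule P) (D : Fin P.n → Valuation P) (ω : Noise P) :
    feedback pick D ω (partialSums pick D ω) = partialSums pick D ω := by
  have h := (agreeBefore_iterate_feedback pick D ω (feedback pick D ω 0) 0
    P.horizon).feedback_eq pick D ω
  rwa [← Function.iterate_succ_apply, Function.iterate_succ_apply',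
    ← Function.iterate_succ_apply' (feedback pick D ω)] at h

theorem eq_partialSums_of_feedback_eq {pick : ChoiceRule P} {D : Fin P.n → Valuation P}
    {ω : Noise P} (h : feedback pick D ω s = s) : s = partialSums pick D ω := by
  have h' := (agreeBefore_iterate_feedback pick D ω s 0 P.horizon).feedback_eq pick D ω
  rwa [Function.iterate_fixed h, h, ← Function.iterate_succ_apply' (feedback pick D ω)] at h'

end PMatch
end

noncomputable section
namespace PMatch

variable {P : Params} {pick : ChoiceRule P} {D : Fin P.n → Valuation P} {ω s : Noise P}

/-! ### The run of the algorithm in closed form -/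

theorem reading_eq_tally (hs : feedback pick D ω s = s) {c : CounterId P} {t : ℕ}
    (ht : t ≤ P.horizon) (hc : ∀ e < t, IsReleased P c e) :
    reading P ω c ((List.range t).map (bitAt pick D s c)) = tally s c t := by
  unfold reading tally
  rw [List.length_map, List.length_range]
  refine binaryMechanism_eq_of_partialSums fun e he => ?_
  have heN : e < P.horizon := he.trans_le ht
  have h := congrFun (congrFun hs c) ⟨e, heN⟩
  simp only [feedback, if_pos (hc e he)] at h
  simp only [add_tsub_cancel_right, dif_pos heN]
  rw [← h]
  congr 1
  refine Finset.sum_congr rfl fun u hu => ?_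
  rw [dyadicBlock, Finset.mem_Ico] at hu
  have hut : u < t := by omega
  simp [List.getD_eq_getElem?_getD, hut]

/-- The state of the algorithm after `t` calls of `Bid` and `t₀` bits fed to `counter(0)`, when the
bidders have the data `x`. -/
def closedState (pick : ChoiceRule P) (D : Fin P.n → Valuation P) (ω s : Noise P) (t t₀ : ℕ)
    (x : Fin P.n → BidderState P) : State P where
  stream
    | none => (List.range t₀).map (bitAt pick D s none)
    | some j => (List.range t).map (bitAt pick D s (some j))
  count j := tally s (some j) t
  increments := incrementsAt s t
  status b := (x b).1
  saved b := savedCount s (x b).2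
  halted := false
  bidLog := (List.range t).map fun u =>
    (fun j => tally s (some j) (u + 1), fun j => P.α * incrementsAt s (u + 1) j)
  unsatisfiedLog := (List.range t₀).map fun u =>
    reading P ω none ((List.range (u + 1)).map (bitAt pick D s none))

theorem bitAt_round (b : Fin P.n) (r : ℕ) (c : CounterId P) :
    bitAt pick D s c (r * P.n + b) = bidderBit pick b (D b) s r c := by
  have hn : 0 < P.n := b.pos
  have hmod : (r * P.n + b) % P.n = b := by
    rw [Nat.mul_add_mod', Nat.mod_eq_of_lt b.2]
  have hdiv : (r * P.n + b) / P.n = r := by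
    rw [add_comm, Nat.add_mul_div_right _ _ hn, Nat.div_eq_of_lt b.2, zero_add]
  have hb : (⟨(r * P.n + b) % P.n, Nat.mod_lt _ hn⟩ : Fin P.n) = b := Fin.ext hmod
  rw [bitAt, dif_pos hn, hb, hdiv]

theorem State.ext_fields {st st' : State P} (h₁ : ∀ c, st.stream c = st'.stream c)
    (h₂ : st.count = st'.count) (h₃ : st.increments = st'.increments)
    (h₄ : ∀ b, st.status b = st'.status b) (h₅ : ∀ b, st.saved b = st'.saved b)
    (h₆ : st.halted = st'.halted) (h₇ : st.bidLog = st'.bidLog)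
    (h₈ : st.unsatisfiedLog = st'.unsatisfiedLog) : st = st' := by
  cases st
  cases st'
  obtain rfl := funext h₁
  obtain rfl := funext h₄
  obtain rfl := funext h₅
  subst h₂ h₃ h₆ h₇ h₈
  rfl

/-- The hypotheses are stated field by field because a proposal edits `status` and `saved` before
calling `bid`. Nothing is asked of `count`, which `bid` overwrites. -/
theorem bid_closedState (hs : feedback pick D ω s = s) {t : ℕ} (ht : t + 1 ≤ P.horizon) (t₀ : ℕ)
    (x : Fin P.n → BidderState P) {a : Fin P.k → ℕ}
    (ha : ∀ j, a j = bitAt pick D s (some j) t) (st : State P)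
    (h₁ : st.stream = (closedState pick D ω s t t₀ x).stream)
    (h₂ : st.increments = incrementsAt s t)
    (h₃ : ∀ b, st.status b = (x b).1)
    (h₄ : ∀ b, st.saved b = savedCount s (x b).2)
    (h₅ : st.halted = false)
    (h₆ : st.bidLog = (closedState pick D ω s t t₀ x).bidLog)
    (h₇ : st.unsatisfiedLog = (closedState pick D ω s t t₀ x).unsatisfiedLog) :
    bid ω a st = closedState pick D ω s (t + 1) t₀ x := by
  have hstream : ∀ j, st.stream (some j) ++ [a j] =
      (List.range (t + 1)).map (bitAt pick D s (some j)) := by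
    intro j
    rw [h₁, ha, List.range_succ, List.map_append]
    rfl
  have hcount : (bid ω a st).count = fun j => tally s (some j) (t + 1) := by
    funext j
    change reading P ω (some j) (st.stream (some j) ++ [a j]) = _
    rw [hstream, reading_eq_tally hs ht fun _ _ => by trivial]
  have hinc : (bid ω a st).increments = incrementsAt s (t + 1) := by
    funext j
    change (if (P.α * st.increments j / P.α + 1) * (P.s - P.m) ≤ (bid ω a st).count j then
      st.increments j + 1 else st.increments j) = _
    rw [hcount, h₂]
    rfl
  refine State.ext_fields ?_ hcount hinc h₃ h₄ h₅ ?_ h₇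
  · rintro (_ | j)
    · exact congrFun h₁ none
    · exact hstream j
  · change st.bidLog ++ [((bid ω a st).count, fun j => P.α * (bid ω a st).increments j)] = _
    rw [hcount, hinc, h₆]
    simp only [closedState]
    rw [List.range_succ (n := t), List.map_append]
    rfl

open Classical in
theorem proposeBidder_closedState (hs : feedback pick D ω s = s) {r : ℕ} {b : Fin P.n}
    (ht : r * P.n + b + 1 ≤ P.horizon) (t₀ : ℕ) {x : Fin P.n → BidderState P}
    (hx : x b = bidderAt pick b (D b) s r) :
    proposeBidder pick D ω (closedState pick D ω s (r * P.n + b) t₀ x) b =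
      closedState pick D ω s (r * P.n + b + 1) t₀
        (Function.update x b (proposedAt pick b (D b) s r)) := by
  set t := r * P.n + b with htdef
  have hupd : proposedAt pick b (D b) s r = x b →
      Function.update x b (proposedAt pick b (D b) s r) = x := by
    intro h; rw [h, Function.update_eq_self]
  have hbit : ∀ j, bitAt pick D s (some j) t = if (bidderAt pick b (D b) s r).1 = .unassigned ∧
      (proposedAt pick b (D b) s r).1 = .good j then 1 else 0 := fun j => by
    rw [htdef, bitAt_round]
    rfl
  have hprop : proposedAt pick b (D b) s r = proposeAt pick b (D b) (incrementsAt s t) t (x b) := by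
    rw [hx]; rfl
  rw [← hx] at hbit
  unfold proposeBidder
  rcases hxb : x b with ⟨_ | _ | j, d⟩
  · have hst : (closedState pick D ω s t t₀ x).status b = .unassigned := by
      simp [closedState, hxb]
    rw [hst]
    set j := pick b (D b) fun j => P.α * incrementsAt s t j with hj
    rw [hxb] at hprop
    simp only [proposeAt, ← hj] at hprop
    change (if (D b j : ℝ) - P.α * incrementsAt s t j ≤ 0 then _ else _) = _
    by_cases hv : (D b j : ℝ) - P.α * incrementsAt s t j ≤ 0
    · rw [if_pos hv] at hprop ⊢
      refine bid_closedState hs ht t₀ _ (fun j' => ?_) _ rfl rfl (fun b' => ?_) (fun b' => ?_)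
        rfl rfl rfl
      · simp [hbit, hprop]
      · rcases eq_or_ne b' b with rfl | hb
        · simp [hprop]
        · simp [hb, closedState]
      · rcases eq_or_ne b' b with rfl | hb
        · simp [hprop, closedState, hxb]
        · simp [hb, closedState]
    · rw [if_neg hv] at hprop ⊢
      refine bid_closedState hs ht t₀ _ (fun j' => ?_) _ rfl rfl (fun b' => ?_) (fun b' => ?_)
        rfl rfl rfl
      · rcases eq_or_ne j' j with hj' | hj'
        · rw [hj']
          change (Pi.single j 1 : Fin P.k → ℕ) j = _
          simp [hbit, hprop, hxb]
        · change (Pi.single j 1 : Fin P.k → ℕ) j' = _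
          simp [hbit, hprop, hxb, hj', hj'.symm]
      · rcases eq_or_ne b' b with rfl | hb
        · simp [hprop]; rfl
        · simp [hb, closedState]
      · rcases eq_or_ne b' b with rfl | hb
        · simp [hprop, closedState, savedCount]; rfl
        · simp [hb, closedState]
  · have hst : (closedState pick D ω s t t₀ x).status b = .dummy := by
      simp [closedState, hxb]
    rw [hst, hupd (by rw [hprop, hxb]; rfl)]
    exact bid_closedState hs ht t₀ _ (fun j => by simp [hbit, hxb]) _ rfl rfl (fun _ => rfl)
      (fun _ => rfl) rfl rfl rfl
  · have hst : (closedState pick D ω s t t₀ x).status b = .good j := by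
      simp [closedState, hxb]
    rw [hst, hupd (by rw [hprop, hxb]; rfl)]
    exact bid_closedState hs ht t₀ _ (fun j => by simp [hbit, hxb]) _ rfl rfl (fun _ => rfl)
      (fun _ => rfl) rfl rfl rfl

theorem report_closedState (t t₀ : ℕ) (x : Fin P.n → BidderState P) {a : ℕ}
    (ha : bitAt pick D s none t₀ = a) (st : State P)
    (h₁ : st.stream = (closedState pick D ω s t t₀ x).stream)
    (h₂ : st.count = (closedState pick D ω s t t₀ x).count)
    (h₃ : st.increments = incrementsAt s t)
    (h₄ : ∀ b, st.status b = (x b).1)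
    (h₅ : ∀ b, st.saved b = savedCount s (x b).2)
    (h₆ : st.halted = false)
    (h₇ : st.bidLog = (closedState pick D ω s t t₀ x).bidLog)
    (h₈ : st.unsatisfiedLog = (closedState pick D ω s t t₀ x).unsatisfiedLog) :
    report ω a st = closedState pick D ω s t (t₀ + 1) x := by
  subst ha
  have hstream : st.stream none ++ [bitAt pick D s none t₀] =
      (List.range (t₀ + 1)).map (bitAt pick D s none) := by
    rw [h₁, List.range_succ, List.map_append]
    rfl
  refine State.ext_fields ?_ h₂ h₃ h₄ h₅ h₆ h₇ ?_
  · rintro (_ | j)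
    · simp only [report, Function.update_self]
      exact hstream
    · simp [report, h₁, closedState]
  · change st.unsatisfiedLog ++ [reading P ω none (st.stream none ++ [_])] = _
    rw [hstream, h₈]
    simp only [closedState]
    rw [← List.map_singleton (f := fun u =>
      reading P ω none ((List.range (u + 1)).map (bitAt pick D s none))), ← List.map_append,
      ← List.range_succ]

open Classical in
theorem countBidder_closedState {r : ℕ} {b : Fin P.n} {x : Fin P.n → BidderState P}
    (hx : x b = proposedAt pick b (D b) s r) :
    countBidder ω (closedState pick D ω s ((r + 1) * P.n) (r * P.n + b) x) b =
      closedState pick D ω s ((r + 1) * P.n) (r * P.n + b + 1)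
        (Function.update x b (bidderAt pick b (D b) s (r + 1))) := by
  have hnext : bidderAt pick b (D b) s (r + 1) = releaseAt s r (x b) := by rw [hx]; rfl
  have hbit : bitAt pick D s none (r * P.n + b) = if Unsatisfied s r (x b) then 1 else 0 := by
    rw [bitAt_round, hx]; rfl
  unfold countBidder
  unfold releaseAt at hnext
  split_ifs with h
  · replace h : Unsatisfied s r (x b) := h
    rw [if_pos h] at hbit hnext
    refine report_closedState _ _ _ hbit _ rfl rfl rfl (fun b' => ?_) (fun b' => ?_) rfl rfl rfl
    · rcases eq_or_ne b' b with rfl | hb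
      · simp [hnext]
      · simp [hb, closedState]
    · rcases eq_or_ne b' b with rfl | hb
      · simp [hnext, closedState]
      · simp [hb, closedState]
  · replace h : ¬ Unsatisfied s r (x b) := h
    rw [if_neg h] at hbit hnext
    rw [hnext, Function.update_eq_self]
    exact report_closedState _ _ _ hbit _ rfl rfl rfl (fun _ => rfl) (fun _ => rfl) rfl rfl rfl

/-! ### From single turns to whole rounds -/

/-- A loop invariant: `q m` is the state after the first `m` bidders. -/
theorem foldl_finRange_eq {α : Type*} {n : ℕ} (f : α → Fin n → α) (q : ℕ → α)
    (h : ∀ b : Fin n, f (q b) b = q (b + 1)) : (List.finRange n).foldl f (q 0) = q n := by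
  induction n with
  | zero => rfl
  | succ n ih =>
    rw [List.finRange_succ_last, List.foldl_append, List.foldl_map,
      ih (fun a b => f a b.castSucc) fun b => h b.castSucc]
    exact h (Fin.last n)

/-- The data of the bidders in round `r`, when the first `m` of them have made their turn. -/
def partway {n : ℕ} {X : Type*} (x x' : Fin n → X) (m : ℕ) : Fin n → X :=
  fun b => if (b : ℕ) < m then x' b else x b

theorem update_partway {n : ℕ} {X : Type*} (x x' : Fin n → X) (b : Fin n) :
    Function.update (partway x x' b) b (x' b) = partway x x' (b + 1) := by
  funext b'
  rcases eq_or_ne b' b with rfl | hb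
  · simp [partway]
  · have : (b' : ℕ) ≠ b := fun h => hb (Fin.ext h)
    simp only [Function.update_of_ne hb, partway]
    congr 1
    apply propext
    omega

theorem partway_zero {n : ℕ} {X : Type*} (x x' : Fin n → X) : partway x x' 0 = x := by
  funext b; simp [partway]

theorem partway_all {n : ℕ} {X : Type*} (x x' : Fin n → X) : partway x x' n = x' := by
  funext b; simp [partway]

/-- The state after `r` rounds, if the algorithm has not halted. -/
def roundState (pick : ChoiceRule P) (D : Fin P.n → Valuation P) (ω s : Noise P) (r : ℕ) :
    State P :=
  closedState pick D ω s (r * P.n) (r * P.n) fun b => bidderAt pick b (D b) s r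

open Classical in
theorem round_roundState (hs : feedback pick D ω s = s) {r : ℕ} (hr : r < P.T) :
    round pick D ω (roundState pick D ω s r) =
      if reading P ω none ((List.range ((r + 1) * P.n)).map (bitAt pick D s none)) -
          reading P ω none ((List.range (r * P.n)).map (bitAt pick D s none))
            < P.ρ * P.n - 2 * P.E then
        halt (roundState pick D ω s (r + 1))
      else roundState pick D ω s (r + 1) := by
  have hN : (r + 1) * P.n ≤ P.horizon := by
    rw [Params.horizon, mul_comm]
    exact Nat.mul_le_mul_left _ hr
  have h₁ : (List.finRange P.n).foldl (proposeBidder pick D ω) (roundState pick D ω s r) =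
      closedState pick D ω s ((r + 1) * P.n) (r * P.n)
        fun b => proposedAt pick b (D b) s r := by
    have := foldl_finRange_eq (proposeBidder pick D ω) (fun m =>
      closedState pick D ω s (r * P.n + m) (r * P.n)
        (partway (fun b => bidderAt pick b (D b) s r) (fun b => proposedAt pick b (D b) s r) m))
      fun b => by
        rw [proposeBidder_closedState hs _ _ (by simp [partway]),
          update_partway _ fun b => proposedAt pick b (D b) s r]
        · rfl
        · have := b.2
          rw [add_mul] at hN
          omega
    rw [partway_zero, partway_all] at this
    rw [add_mul, one_mul]
    exact this
  have h₂ : (List.finRange P.n).foldl (countBidder ω)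
      (closedState pick D ω s ((r + 1) * P.n) (r * P.n) fun b => proposedAt pick b (D b) s r) =
      roundState pick D ω s (r + 1) := by
    have := foldl_finRange_eq (countBidder ω) (fun m =>
      closedState pick D ω s ((r + 1) * P.n) (r * P.n + m)
        (partway (fun b => proposedAt pick b (D b) s r)
          (fun b => bidderAt pick b (D b) s (r + 1)) m))
      fun b => by
        rw [countBidder_closedState (by simp [partway]),
          update_partway _ fun b => bidderAt pick b (D b) s (r + 1)]
        rfl
    rw [partway_zero, partway_all] at this
    rw [add_zero] at this
    rw [this, roundState, add_mul, one_mul]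
  unfold round
  rw [if_neg (by simp [roundState, closedState])]
  simp only [h₁, h₂]
  rfl

theorem roundState_zero : roundState pick D ω s 0 = initialState P := by
  unfold roundState
  rw [zero_mul]
  refine State.ext_fields ?_ ?_ rfl (fun _ => rfl) (fun _ => rfl) rfl ?_ ?_
  · rintro (_ | j) <;> simp [closedState, initialState]
  · funext j
    simp [closedState, initialState, tally, binaryMechanism]
  · simp [closedState, initialState]
  · simp [closedState, initialState]

end PMatch
end

noncomputable section
namespace PMatch

variable {P : Params} {pick : ChoiceRule P} {D D' : Fin P.n → Valuation P} {ω ω' s : Noise P}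

/-! ### The noisy partial sums determine the public part of the run -/

/-- The public parts of two states agree, and so do the goods of the bidders with the same
valuation in `D` and `D'`. -/
structure SamePublic (D D' : Fin P.n → Valuation P) (st st' : State P) : Prop where
  increments : st.increments = st'.increments
  bidLog : st.bidLog = st'.bidLog
  unsatisfiedLog :
    st.unsatisfiedLog.take (P.n * (P.T - 1)) = st'.unsatisfiedLog.take (P.n * (P.T - 1))
  allocation : ∀ b, D b = D' b → st.allocation b = st'.allocation b

theorem allocation_halt (st : State P) (b : Fin P.n) :
    (halt st).allocation b = st.allocation b := by
  simp only [State.allocation, halt]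
  cases st.status b <;> rfl

theorem SamePublic.halt_left {st st' : State P} (h : SamePublic D D' st st') :
    SamePublic D D' (halt st) st' :=
  ⟨h.increments, h.bidLog, h.unsatisfiedLog, fun b hb =>
    (allocation_halt st b).trans (h.allocation b hb)⟩

theorem SamePublic.halt_right {st st' : State P} (h : SamePublic D D' st st') :
    SamePublic D D' st (halt st') :=
  ⟨h.increments, h.bidLog, h.unsatisfiedLog, fun b hb =>
    (h.allocation b hb).trans (allocation_halt st' b).symm⟩

theorem reading_none_eq_tally (hs : feedback pick D ω s = s) {t : ℕ}
    (ht : t ≤ P.n * (P.T - 1)) :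
    reading P ω none ((List.range t).map (bitAt pick D s none)) = tally s none t :=
  reading_eq_tally hs (ht.trans (Nat.mul_le_mul_left _ (Nat.sub_le _ _)))
    fun _ he => he.trans_le ht

theorem samePublic_roundState (hs : feedback pick D ω s = s) (hs' : feedback pick D' ω' s = s)
    (r : ℕ) : SamePublic D D' (roundState pick D ω s r) (roundState pick D' ω' s r) where
  increments := rfl
  bidLog := rfl
  unsatisfiedLog := by
    simp only [roundState, closedState, ← List.map_take, List.take_range]
    refine List.map_congr_left fun u hu => ?_
    have hu' : u + 1 ≤ P.n * (P.T - 1) := by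
      have := List.mem_range.1 hu
      omega
    rw [reading_none_eq_tally hs hu', reading_none_eq_tally hs' hu']
  allocation b hb := by simp only [State.allocation, roundState, closedState, hb]

theorem round_halt (st : State P) : round pick D ω (halt st) = halt st := by
  unfold round
  rw [if_pos (show (halt st).halted = true from rfl)]

/-- With `r < P.T`, every test carried out so far compares released tallies of `counter(0)`. These
are read off `s`, so both runs halt in the same round or not at all. -/
theorem iterate_round_eq (hs : feedback pick D ω s = s) (hs' : feedback pick D' ω' s = s) {r : ℕ}
    (hr : r < P.T) :
    ((round pick D ω)^[r] (initialState P) = roundState pick D ω s r ∧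
      (round pick D' ω')^[r] (initialState P) = roundState pick D' ω' s r) ∨
    ∃ r', (round pick D ω)^[r] (initialState P) = halt (roundState pick D ω s r') ∧
      (round pick D' ω')^[r] (initialState P) = halt (roundState pick D' ω' s r') := by
  induction r with
  | zero => exact .inl ⟨roundState_zero.symm, roundState_zero.symm⟩
  | succ r ih =>
    rw [Function.iterate_succ_apply', Function.iterate_succ_apply']
    rcases ih (by omega) with ⟨h, h'⟩ | ⟨r', h, h'⟩
    · have h₁ : (r + 1) * P.n ≤ P.n * (P.T - 1) := by
        rw [mul_comm]
        exact Nat.mul_le_mul_left _ (by omega)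
      have h₀ : r * P.n ≤ P.n * (P.T - 1) := by
        rw [mul_comm]
        exact Nat.mul_le_mul_left _ (by omega)
      rw [h, h', round_roundState hs (by omega), round_roundState hs' (by omega),
        reading_none_eq_tally hs h₀, reading_none_eq_tally hs h₁,
        reading_none_eq_tally hs' h₀, reading_none_eq_tally hs' h₁]
      split_ifs
      · exact .inr ⟨r + 1, rfl, rfl⟩
      · exact .inl ⟨rfl, rfl⟩
    · rw [h, h', round_halt, round_halt]
      exact .inr ⟨r', rfl, rfl⟩

/-- In the last round one run may halt and the other not. Halting alters no component of
`SamePublic`, so all four combinations agree. -/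
theorem samePublic_finalState (hT : 0 < P.T) (hs : feedback pick D ω s = s)
    (hs' : feedback pick D' ω' s = s) :
    SamePublic D D' (finalState pick D ω) (finalState pick D' ω') := by
  obtain ⟨r, hr⟩ : ∃ r, P.T = r + 1 := ⟨P.T - 1, by omega⟩
  unfold finalState
  rw [hr, Function.iterate_succ_apply', Function.iterate_succ_apply']
  have hrT : r < P.T := by omega
  rcases iterate_round_eq hs hs' hrT with ⟨h, h'⟩ | ⟨r', h, h'⟩
  · have key := samePublic_roundState hs hs' (r + 1)
    rw [h, h', round_roundState hs hrT, round_roundState hs' hrT]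
    split_ifs
    exacts [key.halt_left.halt_right, key.halt_left, key.halt_right, key]
  · rw [h, h', round_halt, round_halt]
    exact (samePublic_roundState hs hs' r').halt_left.halt_right

theorem trajectory_eq (hT : 0 < P.T) (h : partialSums pick D ω = partialSums pick D' ω') :
    trajectory pick D ω = trajectory pick D' ω' := by
  have key := samePublic_finalState hT (feedback_partialSums pick D ω)
    (h ▸ feedback_partialSums pick D' ω')
  simp only [trajectory, key.bidLog, key.unsatisfiedLog]

theorem output_eq (hT : 0 < P.T) (h : partialSums pick D ω = partialSums pick D' ω')
    {b : Fin P.n} (hb : D b = D' b) : output pick D ω b = output pick D' ω' b := by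
  have key := samePublic_finalState hT (feedback_partialSums pick D ω)
    (h ▸ feedback_partialSums pick D' ω')
  refine Prod.ext ?_ (key.allocation b hb)
  funext j
  simp only [output, State.price, key.increments]

end PMatch
end

noncomputable section

/-! ### The number of partial sums that contain a given position -/

theorem dyadicBlock_eq_of_mem {u e : ℕ} (h : u ∈ dyadicBlock e) :
    e + 1 = (u / 2 ^ padicValNat 2 (e + 1) + 1) * 2 ^ padicValNat 2 (e + 1) ∧
      u.testBit (padicValNat 2 (e + 1)) = false := by
  rw [dyadicBlock, Finset.mem_Ico] at h
  set i := padicValNat 2 (e + 1) with hi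
  obtain ⟨q, hq⟩ : 2 ^ i ∣ e + 1 := pow_padicValNat_dvd
  have hodd : ¬ 2 ∣ q := by
    rintro ⟨q', rfl⟩
    refine pow_succ_padicValNat_not_dvd (p := 2) (n := e + 1) (by omega) ?_
    rw [← hi]
    exact ⟨q', by rw [hq]; ring⟩
  have hq0 : q ≠ 0 := by rintro rfl; simp at hodd
  obtain ⟨a, rfl⟩ : ∃ a, q = a + 1 := ⟨q - 1, by omega⟩
  have h2 : 0 < 2 ^ i := by positivity
  have hdiv : u / 2 ^ i = a := by
    rw [hq] at h
    apply Nat.div_eq_of_lt_le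
    · rw [mul_comm]; rw [mul_add] at h; omega
    · rw [mul_comm]; exact h.2
  refine ⟨by rw [hdiv, hq, mul_comm], ?_⟩
  rw [Nat.testBit_eq_decide_div_mod_eq, hdiv]
  simp
  omega

/-- The number of partial sums, among the first `N`, that contain the position `u`. -/
def blockCount (N u : ℕ) : ℕ := ((Finset.range N).filter fun e => u ∈ dyadicBlock e).card

/-- Inject a block into its level `i`. A block of level `i` containing `u` exists only if digit `i`
of `u` is `0`, and it must end at the next multiple of `2 ^ i` after `u`. -/
theorem blockCount_le (N u : ℕ) :
    blockCount N u ≤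
      ((Finset.range (Nat.log 2 N + 1)).filter fun i => u.testBit i = false).card := by
  refine Finset.card_le_card_of_injOn (fun e => padicValNat 2 (e + 1)) ?_ ?_
  · intro e he
    simp only [Finset.coe_filter, Finset.mem_range, Set.mem_ofPred_eq] at he ⊢
    refine ⟨?_, (dyadicBlock_eq_of_mem he.2).2⟩
    have hle : 2 ^ padicValNat 2 (e + 1) ≤ N :=
      (Nat.le_of_dvd (by omega) pow_padicValNat_dvd).trans he.1
    exact Nat.lt_succ_of_le (Nat.le_log_of_pow_le (by norm_num) hle)
  · intro e he e' he' heq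
    simp only [Finset.coe_filter, Finset.mem_range, Set.mem_ofPred_eq] at he he' heq
    have h := (dyadicBlock_eq_of_mem he.2).1
    have h' := (dyadicBlock_eq_of_mem he'.2).1
    rw [heq, ← h'] at h
    omega

theorem blockCount_add_card_le {N u : ℕ} {A : Finset ℕ}
    (hA : ∀ i ∈ A, i ≤ Nat.log 2 N ∧ u.testBit i = true) :
    blockCount N u + A.card ≤ Nat.log 2 N + 1 := by
  have hdisj : Disjoint
      ((Finset.range (Nat.log 2 N + 1)).filter fun i => u.testBit i = false) A := by
    rw [Finset.disjoint_left]
    intro i hi hiA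
    have := (Finset.mem_filter.1 hi).2
    rw [(hA i hiA).2] at this
    simp at this
  calc _ ≤ _ := Nat.add_le_add_right (blockCount_le N u) _
    _ = _ := (Finset.card_union_of_disjoint hdisj).symm
    _ ≤ (Finset.range (Nat.log 2 N + 1)).card := by
      refine Finset.card_le_card (Finset.union_subset (Finset.filter_subset _ _) fun i hi => ?_)
      exact Finset.mem_range.2 (Nat.lt_succ_of_le (hA i hi).1)
    _ = _ := Finset.card_range _

theorem blockCount_le_log_succ (N u : ℕ) : blockCount N u ≤ Nat.log 2 N + 1 := by
  simpa using blockCount_add_card_le (N := N) (u := u) (A := ∅) (by simp)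

theorem le_log_of_testBit {N u i : ℕ} (hu : u < N) (h : u.testBit i = true) :
    i ≤ Nat.log 2 N :=
  Nat.le_log_of_pow_le (by norm_num) ((Nat.ge_two_pow_of_testBit h).trans hu.le)

theorem blockCount_le_log {N u : ℕ} (h0 : u ≠ 0) (hu : u < N) :
    blockCount N u ≤ Nat.log 2 N := by
  obtain ⟨i, hi⟩ := Nat.exists_testBit_of_ne_zero h0
  have := blockCount_add_card_le (N := N) (u := u) (A := {i})
    (by simpa [hi] using le_log_of_testBit hu hi)
  simpa using this

/-- A nonzero `u` with an odd divisor `p ≠ 1` is no power of two. It has two nonzero digits, each of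
which removes one level. -/
theorem blockCount_succ_le_log {N u p : ℕ} (h0 : u ≠ 0) (hu : u < N) (hp : p ∣ u)
    (hcop : p.Coprime 2) (hp1 : p ≠ 1) : blockCount N u + 1 ≤ Nat.log 2 N := by
  obtain ⟨i, hi⟩ := Nat.exists_testBit_of_ne_zero h0
  obtain ⟨i', hne, hi'⟩ : ∃ i', i' ≠ i ∧ u.testBit i' = true := by
    by_contra! hcon
    have : u = 2 ^ i := by
      apply Nat.eq_of_testBit_eq
      intro l
      rw [Nat.testBit_two_pow]
      rcases eq_or_ne l i with rfl | hl
      · simpa using hi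
      · simpa [hl.symm] using hcon l hl
    rw [this] at hp
    exact hp1 ((hcop.pow_right i).eq_one_of_dvd hp)
  have := blockCount_add_card_le (N := N) (u := u) (A := {i', i}) (by
    intro l hl
    simp only [Finset.mem_insert, Finset.mem_singleton] at hl
    rcases hl with rfl | rfl
    · exact ⟨le_log_of_testBit hu hi', hi'⟩
    · exact ⟨le_log_of_testBit hu hi, hi⟩)
  rw [Finset.card_pair hne] at this
  omega

/-- The weighted total of the changed bits: `x r` changed bids and `y r` changed reports in
round `r`, in position `b` of `n`. -/
theorem sum_blockCount_le {n T b : ℕ} (hb : b < n) (hT : 8 ≤ T) {x y : ℕ → ℕ}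
    (hx : x 0 ≤ 2) (hxy : ∀ r, y r + x (r + 1) ≤ 2) (hy : ∀ r, y r ≤ 1) :
    ∑ r ∈ Finset.range T, blockCount (n * T) (r * n + b) * x r +
      ∑ r ∈ Finset.range (T - 1), blockCount (n * T) (r * n + b) * y r ≤
        2 * T * Nat.log 2 (n * T) := by
  set L := Nat.log 2 (n * T) with hL
  set l : ℕ → ℕ := fun r => blockCount (n * T) (r * n + b) with hl
  have hlt : ∀ r < T, r * n + b < n * T := by
    intro r hr
    calc r * n + b < (r + 1) * n := by rw [add_mul]; omega
      _ ≤ n * T := by rw [mul_comm]; exact Nat.mul_le_mul_left _ hr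
  have hL1 : 1 ≤ L := by
    rw [hL]
    apply Nat.le_log_of_pow_le (by norm_num)
    nlinarith
  obtain ⟨T', rfl⟩ : ∃ T', T = T' + 1 := ⟨T - 1, by omega⟩
  -- Pair the reports of round `r` with the bids of round `r + 1`; the bids of round `0` stay alone.
  rw [Finset.sum_range_succ', Nat.add_sub_cancel, add_right_comm, ← Finset.sum_add_distrib]
  change ∑ r ∈ Finset.range T', (l (r + 1) * x (r + 1) + l r * y r) + l 0 * x 0 ≤ _
  have hl1 : ∀ r ≤ T', r * n + b ≠ 0 → l r ≤ L := fun r hr h0 =>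
    blockCount_le_log h0 (hlt r (by omega))
  have hl0 : l 0 ≤ L + 1 := blockCount_le_log_succ _ _
  have hpos : ∀ r, (r + 1) * n + b ≠ 0 := fun r => by
    have : 0 < (r + 1) * n := Nat.mul_pos r.succ_pos (by omega)
    omega
  have gen : ∀ r < T', l r ≤ L → l (r + 1) * x (r + 1) + l r * y r ≤ 2 * L := by
    intro r hr hlr
    calc _ ≤ L * x (r + 1) + L * y r := by
          gcongr
          exact hl1 (r + 1) hr (hpos r)
      _ = L * (y r + x (r + 1)) := by ring
      _ ≤ L * 2 := by gcongr; exact hxy r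
      _ = _ := mul_comm _ _
  -- Only the first bidder meets position `0`, where the block count can be `L + 1`. Her excess is
  -- at most `2` from the first bids (`gx`) and `1` from the first report (`g0`). It is paid back by
  -- the bids of rounds `3`, `5` and `6`, whose positions have an odd factor; this is where `8 ≤ T`
  -- is needed.
  rcases Nat.eq_zero_or_pos b with rfl | hbpos
  · have small : ∀ r < T', 0 < r → l (r + 1) + 1 ≤ L →
        l (r + 1) * x (r + 1) + l r * y r + 1 ≤ 2 * L := by
      intro r hr hr0 hlr
      obtain ⟨q, rfl⟩ : ∃ q, r = q + 1 := ⟨r - 1, by omega⟩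
      have h1 := hl1 (q + 1) (by omega) (hpos q)
      have h2 := hxy (q + 1)
      -- The gain of `1` would fail for two changed reports and no changed bid, so the bound on `y`
      -- alone matters here.
      have h3 := hy (q + 1)
      generalize x (q + 1 + 1) = X at *
      generalize y (q + 1) = Y at *
      have hX : X ≤ 2 := by omega
      interval_cases X <;> interval_cases Y <;> omega
    have hsplit := Finset.sum_range_add_sum_Ico
      (fun r => l (r + 1) * x (r + 1) + l r * y r) (show 7 ≤ T' by omega)
    have htail : ∑ r ∈ Finset.Ico 7 T', (l (r + 1) * x (r + 1) + l r * y r) ≤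
        (T' - 7) * (2 * L) := by
      refine (Finset.sum_le_card_nsmul _ _ (2 * L) fun r hr => ?_).trans ?_
      · rw [Finset.mem_Ico] at hr
        obtain ⟨q, rfl⟩ : ∃ q, r = q + 1 := ⟨r - 1, by omega⟩
        exact gen _ hr.2 (hl1 _ (by omega) (hpos q))
      · simp
    have hn : 0 < n := hb
    have odd : ∀ r p, r < T' + 1 → r ≠ 0 → p ∣ r → p.Coprime 2 → p ≠ 1 → l r + 1 ≤ L := by
      intro r p hr hr0 hpr hp2 hp1
      exact blockCount_succ_le_log (by positivity) (hlt r hr)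
        (by simpa using hpr.mul_right n) hp2 hp1
    have g0 : l 1 * x 1 + l 0 * y 0 ≤ 2 * L + 1 := by
      have h1 := hl1 1 (by omega) (hpos 0)
      have h2 := hxy 0
      have h3 := hy 0
      rw [zero_add] at h2
      generalize x 1 = X at *
      generalize y 0 = Y at *
      have hX : X ≤ 2 := by omega
      interval_cases X <;> interval_cases Y <;> omega
    have gx : l 0 * x 0 ≤ 2 * L + 2 := by
      calc _ ≤ (L + 1) * 2 := by gcongr
        _ = _ := by ring
    have g1 := gen 1 (by omega) (hl1 1 (by omega) (hpos 0))
    have g2 := small 2 (by omega) (by omega)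
      (odd 3 3 (by omega) (by omega) (by norm_num) (by norm_num) (by norm_num))
    have g3 := gen 3 (by omega) (hl1 3 (by omega) (hpos 2))
    have g4 := small 4 (by omega) (by omega)
      (odd 5 5 (by omega) (by omega) (by norm_num) (by norm_num) (by norm_num))
    have g5 := small 5 (by omega) (by omega)
      (odd 6 3 (by omega) (by omega) (by norm_num) (by norm_num) (by norm_num))
    have g6 := gen 6 (by omega) (hl1 6 (by omega) (hpos 5))
    rw [← hsplit]
    have hT' : 2 * (T' + 1) * L = (T' - 7) * (2 * L) + 16 * L := by
      obtain ⟨q, rfl⟩ : ∃ q, T' = q + 7 := ⟨T' - 7, by omega⟩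
      rw [Nat.add_sub_cancel]
      ring
    rw [hT']
    simp only [Finset.sum_range_succ, Finset.sum_range_zero, zero_add]
    norm_num at g0 g1 g2 g3 g4 g5 g6 ⊢
    linarith
  · have hall : ∀ r ≤ T', l r ≤ L := fun r hr => hl1 r hr (by omega)
    have h1 : ∑ r ∈ Finset.range T', (l (r + 1) * x (r + 1) + l r * y r) ≤ T' * (2 * L) := by
      refine (Finset.sum_le_card_nsmul _ _ (2 * L) fun r hr => ?_).trans (by simp)
      rw [Finset.mem_range] at hr
      exact gen r hr (hall r hr.le)
    have h2 : l 0 * x 0 ≤ L * 2 := Nat.mul_le_mul (hall 0 (by omega)) hx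
    calc _ ≤ T' * (2 * L) + L * 2 := add_le_add h1 h2
      _ = _ := by ring

end

/-! ### Double counting of positions and blocks -/

noncomputable section

theorem sum_range_sum_dyadicBlock (N : ℕ) (f : ℕ → ℕ) :
    ∑ e ∈ Finset.range N, ∑ u ∈ dyadicBlock e, f u =
      ∑ u ∈ Finset.range N, blockCount N u * f u := by
  have h : ∀ e ∈ Finset.range N, ∑ u ∈ dyadicBlock e, f u =
      ∑ u ∈ Finset.range N, if u ∈ dyadicBlock e then f u else 0 := by
    intro e he
    rw [← Finset.sum_filter]
    refine Finset.sum_congr ?_ fun _ _ => rfl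
    ext u
    rw [Finset.mem_filter, Finset.mem_range, iff_and_self]
    intro hu
    rw [dyadicBlock, Finset.mem_Ico] at hu
    have := Finset.mem_range.1 he
    omega
  rw [Finset.sum_congr rfl h, Finset.sum_comm]
  refine Finset.sum_congr rfl fun u _ => ?_
  rw [← Finset.sum_filter, Finset.sum_const, smul_eq_mul, blockCount]

theorem blockCount_mono {M N : ℕ} (h : M ≤ N) (u : ℕ) : blockCount M u ≤ blockCount N u :=
  Finset.card_le_card (Finset.filter_subset_filter _ (Finset.range_mono h))

theorem sum_range_mul_eq_of_residue {n b : ℕ} (hb : b < n) (T : ℕ) {g : ℕ → ℕ}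
    (hg : ∀ u, u % n ≠ b → g u = 0) :
    ∑ u ∈ Finset.range (n * T), g u = ∑ r ∈ Finset.range T, g (r * n + b) := by
  induction T with
  | zero => simp
  | succ T ih =>
    rw [mul_add, mul_one, Finset.sum_range_add, ih, Finset.sum_range_succ, mul_comm n T]
    congr 1
    refine Finset.sum_eq_single b (fun b' hb' hne => hg _ ?_) fun h => ?_
    · rw [Nat.mul_add_mod', Nat.mod_eq_of_lt (Finset.mem_range.1 hb')]
      exact hne
    · exact absurd (Finset.mem_range.2 hb) h

namespace PMatch

variable {P : Params} {pick : ChoiceRule P} {D D' : Fin P.n → Valuation P} {s : Noise P}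

/-! ### Sensitivity of the partial sums -/

open Classical in
/-- The change of the noise that makes up for the change of the data from `D` to `D'`, when the
noisy partial sums are `s`. -/
def noiseShift (pick : ChoiceRule P) (D D' : Fin P.n → Valuation P) (s : Noise P)
    (c : CounterId P) (e : Fin P.horizon) : ℤ :=
  if IsReleased P c e then
    ∑ u ∈ dyadicBlock e, ((bitAt pick D s c u : ℤ) - bitAt pick D' s c u)
  else 0

/-- The change of a bit. -/
def bitDist (pick : ChoiceRule P) (D D' : Fin P.n → Valuation P) (s : Noise P) (c : CounterId P)
    (u : ℕ) : ℕ :=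
  ((bitAt pick D s c u : ℤ) - bitAt pick D' s c u).natAbs

theorem bitDist_eq_zero {i : Fin P.n} (h : AreNeighborsAt i D D') (c : CounterId P) {u : ℕ}
    (hu : u % P.n ≠ i) : bitDist pick D D' s c u = 0 := by
  have hn : 0 < P.n := i.pos
  have := h ⟨u % P.n, Nat.mod_lt _ hn⟩ fun h => hu (congrArg Fin.val h)
  simp [bitDist, bitAt, hn, this]

theorem natAbs_sum_sub_le (c : CounterId P) (A : Finset ℕ) :
    (∑ u ∈ A, ((bitAt pick D s c u : ℤ) - bitAt pick D' s c u)).natAbs ≤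
      ∑ u ∈ A, bitDist pick D D' s c u := by
  zify
  refine (Finset.abs_sum_le_sum_abs _ _).trans_eq (Finset.sum_congr rfl fun u _ => ?_)
  simp [bitDist]

theorem sum_natAbs_noiseShift_some {i : Fin P.n} (h : AreNeighborsAt i D D') (j : Fin P.k) :
    ∑ e, (noiseShift pick D D' s (some j) e).natAbs ≤
      ∑ r ∈ Finset.range P.T, blockCount (P.n * P.T) (r * P.n + i) *
        bitDist pick D D' s (some j) (r * P.n + i) := by
  calc ∑ e, (noiseShift pick D D' s (some j) e).natAbs
      ≤ ∑ e : Fin P.horizon, ∑ u ∈ dyadicBlock e, bitDist pick D D' s (some j) u := by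
        refine Finset.sum_le_sum fun e _ => ?_
        rw [noiseShift, if_pos (by trivial)]
        exact natAbs_sum_sub_le _ _
    _ = _ := by
      rw [Fin.sum_univ_eq_sum_range (fun e => ∑ u ∈ dyadicBlock e, bitDist pick D D' s (some j) u),
        sum_range_sum_dyadicBlock]
      exact sum_range_mul_eq_of_residue i.2 P.T fun u hu => by simp [bitDist_eq_zero h _ hu]

theorem sum_natAbs_noiseShift_none {i : Fin P.n} (h : AreNeighborsAt i D D') :
    ∑ e, (noiseShift pick D D' s none e).natAbs ≤
      ∑ r ∈ Finset.range (P.T - 1), blockCount (P.n * P.T) (r * P.n + i) *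
        bitDist pick D D' s none (r * P.n + i) := by
  have hle : P.n * (P.T - 1) ≤ P.horizon := Nat.mul_le_mul_left _ (Nat.sub_le _ _)
  calc ∑ e, (noiseShift pick D D' s none e).natAbs
      ≤ ∑ e : Fin P.horizon, if (e : ℕ) < P.n * (P.T - 1) then
          ∑ u ∈ dyadicBlock e, bitDist pick D D' s none u else 0 := by
        refine Finset.sum_le_sum fun e _ => ?_
        by_cases he : (e : ℕ) < P.n * (P.T - 1)
        · rw [noiseShift, if_pos (show IsReleased P none e from he), if_pos he]
          exact natAbs_sum_sub_le _ _
        · rw [noiseShift, if_neg (show ¬ IsReleased P none e from he)]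
          simp
    _ = ∑ e ∈ Finset.range (P.n * (P.T - 1)),
          ∑ u ∈ dyadicBlock e, bitDist pick D D' s none u := by
      rw [Fin.sum_univ_eq_sum_range (fun e => if e < P.n * (P.T - 1) then
        ∑ u ∈ dyadicBlock e, bitDist pick D D' s none u else 0), ← Finset.sum_filter]
      refine Finset.sum_congr ?_ fun _ _ => rfl
      ext e
      simp only [Finset.mem_filter, Finset.mem_range]
      omega
    _ ≤ ∑ u ∈ Finset.range (P.n * (P.T - 1)),
          blockCount (P.n * P.T) u * bitDist pick D D' s none u := by
      rw [sum_range_sum_dyadicBlock]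
      exact Finset.sum_le_sum fun u _ => Nat.mul_le_mul_right _ (blockCount_mono hle u)
    _ = _ := sum_range_mul_eq_of_residue i.2 _ fun u hu => by simp [bitDist_eq_zero h _ hu]

theorem proposedAt_fst_ne (b : Fin P.n) (v : Valuation P) (r : ℕ) :
    (proposedAt pick b v s r).1 ≠ .unassigned := by
  unfold proposedAt
  rcases bidderAt pick b v s r with ⟨_ | _ | _, d⟩
  · simp only [proposeAt]
    split_ifs <;> simp
  · simp [proposeAt]
  · simp [proposeAt]

theorem bidderBit_none_le (b : Fin P.n) (v : Valuation P) (r : ℕ) :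
    bidderBit pick b v s r none ≤ 1 := by
  unfold bidderBit
  split_ifs <;> simp

open Classical in
theorem sum_bidderBit_some_le (b : Fin P.n) (v : Valuation P) (r : ℕ) :
    ∑ j, bidderBit pick b v s r (some j) ≤ 1 := by
  simp only [bidderBit]
  rw [Finset.sum_boole, Nat.cast_id, Finset.card_le_one]
  intro j hj j' hj'
  have h := (Finset.mem_filter.1 hj).2.2
  rw [(Finset.mem_filter.1 hj').2.2] at h
  exact (Status.good.inj h).symm

/-- A bidder is never unassigned after proposing, so only being released, which is what her report
records, lets her bid again. -/
theorem sum_bidderBit_succ_le (b : Fin P.n) (v : Valuation P) (r : ℕ) :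
    ∑ j, bidderBit pick b v s (r + 1) (some j) ≤ bidderBit pick b v s r none := by
  by_cases h : Unsatisfied s r (proposedAt pick b v s r)
  · refine (sum_bidderBit_some_le b v (r + 1)).trans ?_
    rw [bidderBit, if_pos h]
  · have hne : (bidderAt pick b v s (r + 1)).1 ≠ .unassigned := by
      change (releaseAt s r (proposedAt pick b v s r)).1 ≠ _
      rw [releaseAt, if_neg h]
      exact proposedAt_fst_ne b v r
    simp [bidderBit, hne]

theorem sum_bitDist_le (i : Fin P.n) (r : ℕ) :
    ∑ j, bitDist pick D D' s (some j) (r * P.n + i) ≤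
      ∑ j, bidderBit pick i (D i) s r (some j) + ∑ j, bidderBit pick i (D' i) s r (some j) := by
  rw [← Finset.sum_add_distrib]
  refine Finset.sum_le_sum fun j _ => ?_
  rw [bitDist, bitAt_round, bitAt_round]
  omega

/-- The total change of the released partial sums. -/
theorem sum_natAbs_noiseShift_le (hT : 8 ≤ P.T) {i : Fin P.n} (h : AreNeighborsAt i D D') :
    ∑ c, ∑ e, (noiseShift pick D D' s c e).natAbs ≤ 2 * P.T * Nat.log 2 P.horizon := by
  rw [Fintype.sum_option]
  have hsome := (Finset.sum_le_sum fun j (_ : j ∈ Finset.univ) =>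
    sum_natAbs_noiseShift_some (pick := pick) (s := s) h j).trans_eq Finset.sum_comm
  simp only [← Finset.mul_sum] at hsome
  have hround := fun r => sum_bitDist_le (pick := pick) (D := D) (D' := D') (s := s) i r
  have key := sum_blockCount_le (n := P.n) i.2 hT
    (x := fun r => ∑ j, bitDist pick D D' s (some j) (r * P.n + i))
    (y := fun r => bitDist pick D D' s none (r * P.n + i))
    ((hround 0).trans (add_le_add (sum_bidderBit_some_le i (D i) 0)
      (sum_bidderBit_some_le i (D' i) 0)))
    -- If exactly one of the two runs reports, then `y = 1` but only that run can bid next. If both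
    -- report, then `y = 0`.
    (fun r => by
      have h₁ := (hround (r + 1)).trans (add_le_add (sum_bidderBit_succ_le i (D i) r)
        (sum_bidderBit_succ_le i (D' i) r))
      have h₂ := bidderBit_none_le (pick := pick) (s := s) i (D i) r
      have h₃ := bidderBit_none_le (pick := pick) (s := s) i (D' i) r
      simp only [bitDist, bitAt_round] at h₁ ⊢
      omega)
    (fun r => by
      have h₂ := bidderBit_none_le (pick := pick) (s := s) i (D i) r
      have h₃ := bidderBit_none_le (pick := pick) (s := s) i (D' i) r
      simp only [bitDist, bitAt_round]
      omega)
  rw [add_comm]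
  exact (add_le_add hsome (sum_natAbs_noiseShift_none h)).trans key

end PMatch
end

noncomputable section

/-! ### Measurability of the discrete data of the run -/

/-- The fibers of `f` are measurable. -/
def MeasurableFibers {Ω X : Type*} [MeasurableSpace Ω] (f : Ω → X) : Prop :=
  ∀ x, MeasurableSet {ω | f ω = x}

namespace MeasurableFibers

variable {Ω X Y : Type*} [MeasurableSpace Ω]

theorem const (x : X) : MeasurableFibers fun _ : Ω => x := fun _ => MeasurableSet.const _

/-- Conditioning on a countable-valued `f` allows arbitrary dependence of `g` on it. No
measurability of the choice rule in the prices is therefore needed: price increments are integers,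
and a saved count is encoded by the good and time of the bid. -/
theorem bind [Countable X] {f : Ω → X} {g : X → Ω → Y} (hf : MeasurableFibers f)
    (hg : ∀ x, MeasurableFibers (g x)) : MeasurableFibers fun ω => g (f ω) ω := by
  intro y
  have : {ω | g (f ω) ω = y} = ⋃ x, {ω | f ω = x} ∩ {ω | g x ω = y} := by
    ext ω
    simp
  rw [this]
  exact MeasurableSet.iUnion fun x => (hf x).inter (hg x y)

theorem ite {p : Ω → Prop} [DecidablePred p] {f g : Ω → X} (hp : MeasurableSet {ω | p ω})
    (hf : MeasurableFibers f) (hg : MeasurableFibers g) :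
    MeasurableFibers fun ω => if p ω then f ω else g ω := by
  intro x
  have : {ω | (if p ω then f ω else g ω) = x} =
      ({ω | p ω} ∩ {ω | f ω = x}) ∪ ({ω | p ω}ᶜ ∩ {ω | g ω = x}) := by
    ext ω
    by_cases h : p ω <;> simp [h]
  rw [this]
  exact (hp.inter (hf x)).union (hp.compl.inter (hg x))

theorem pi {ι : Type*} [Countable ι] {f : ι → Ω → X} (hf : ∀ j, MeasurableFibers (f j)) :
    MeasurableFibers fun ω j => f j ω := by
  intro x
  have : {ω | (fun j => f j ω) = x} = ⋂ j, {ω | f j ω = x j} := by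
    ext ω
    simp [funext_iff]
  rw [this]
  exact MeasurableSet.iInter fun j => hf j _

theorem measurable [Countable X] [MeasurableSpace X] {f : Ω → X} (hf : MeasurableFibers f) :
    Measurable f := by
  intro A _
  have : f ⁻¹' A = ⋃ x ∈ A, {ω | f ω = x} := by
    ext ω
    simp
  rw [this]
  exact MeasurableSet.biUnion (Set.to_countable A) fun x _ => hf x

end MeasurableFibers

theorem Measurable.measurableFibers {Ω X : Type*} [MeasurableSpace Ω] [MeasurableSpace X]
    [MeasurableSingletonClass X] {f : Ω → X} (hf : Measurable f) : MeasurableFibers f :=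
  fun x => hf (measurableSet_singleton x)

namespace PMatch

variable {P : Params}

instance (k : ℕ) : Countable (Status k) := by
  refine Function.Injective.countable (β := Option (Option (Fin k)))
    (f := fun x => match x with
      | .unassigned => none
      | .dummy => some none
      | .good j => some (some j)) ?_
  rintro (_ | _ | j) (_ | _ | j') h <;> simp_all

theorem measurable_tally (c : CounterId P) (t : ℕ) : Measurable fun s : Noise P => tally s c t := by
  unfold tally binaryMechanism
  refine Finset.measurable_sum _ fun i _ => ?_
  refine measurable_const.add ?_
  beta_reduce
  split_ifs
  · fun_prop
  · exact measurable_const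

theorem measurableFibers_incrementsAt (t : ℕ) :
    MeasurableFibers fun s : Noise P => incrementsAt s t := by
  induction t with
  | zero => exact .const _
  | succ t ih =>
    refine ih.bind (g := fun q s j =>
      if (P.α * q j / P.α + 1) * (P.s - P.m) ≤ tally s (some j) (t + 1) then q j + 1 else q j)
      fun q => .pi fun j => ?_
    exact .ite (measurableSet_le measurable_const (measurable_tally _ _)) (.const _) (.const _)

theorem measurable_savedCount (d : Option (Fin P.k × ℕ)) :
    Measurable fun s : Noise P => savedCount s d := by
  rcases d with _ | ⟨j, t⟩
  · exact measurable_const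
  · exact measurable_tally _ _

theorem measurableSet_unsatisfied (r : ℕ) (x : BidderState P) :
    MeasurableSet {s : Noise P | Unsatisfied s r x} := by
  have : {s : Noise P | Unsatisfied s r x} = ⋃ j, {s | x.1 = .good j ∧
      (P.s - P.m : ℝ) ≤ tally s (some j) ((r + 1) * P.n) - savedCount s x.2} := by
    ext s
    simp [Unsatisfied]
  rw [this]
  exact MeasurableSet.iUnion fun j => (MeasurableSet.const _).inter
    (measurableSet_le measurable_const ((measurable_tally _ _).sub (measurable_savedCount _)))

theorem measurableFibers_proposedAt_of {pick : ChoiceRule P} {b : Fin P.n} {v : Valuation P}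
    {r : ℕ} (h : MeasurableFibers fun s : Noise P => bidderAt pick b v s r) :
    MeasurableFibers fun s : Noise P => proposedAt pick b v s r :=
  (measurableFibers_incrementsAt (r * P.n + b)).bind
    (g := fun q s => proposeAt pick b v q (r * P.n + b) (bidderAt pick b v s r)) fun q =>
      h.bind (g := fun x _ => proposeAt pick b v q (r * P.n + b) x) fun _ => .const _

open Classical in
theorem measurableFibers_bidderAt (pick : ChoiceRule P) (b : Fin P.n) (v : Valuation P) (r : ℕ) :
    MeasurableFibers fun s : Noise P => bidderAt pick b v s r := by
  induction r with
  | zero => exact .const _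
  | succ r ih =>
    exact (measurableFibers_proposedAt_of ih).bind (g := fun x s => releaseAt s r x) fun x =>
      .ite (measurableSet_unsatisfied r x) (.const _) (.const _)

theorem measurableFibers_bidderBit (pick : ChoiceRule P) (b : Fin P.n) (v : Valuation P) (r : ℕ)
    (c : CounterId P) : MeasurableFibers fun s : Noise P => bidderBit pick b v s r c := by
  classical
  have h := measurableFibers_bidderAt pick b v r
  have h' := measurableFibers_proposedAt_of h
  rcases c with _ | j
  · exact h'.bind (g := fun x s => if Unsatisfied s r x then 1 else 0) fun x =>
      .ite (measurableSet_unsatisfied r x) (.const _) (.const _)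
  · exact h.bind (g := fun x s => if x.1 = .unassigned ∧
      (proposedAt pick b v s r).1 = .good j then 1 else 0) fun x =>
        h'.bind (g := fun x' _ => if x.1 = .unassigned ∧ x'.1 = .good j then 1 else 0)
          fun _ => .const _

theorem measurable_bitAt (pick : ChoiceRule P) (D : Fin P.n → Valuation P) (c : CounterId P)
    (u : ℕ) : Measurable fun s : Noise P => bitAt pick D s c u := by
  unfold bitAt
  split_ifs
  · exact (measurableFibers_bidderBit pick _ _ _ c).measurable
  · exact measurable_const

theorem measurable_feedback (pick : ChoiceRule P) (D : Fin P.n → Valuation P)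
    {f : Noise P → Noise P} (hf : Measurable f) :
    Measurable fun ω => feedback pick D ω (f ω) := by
  refine measurable_pi_lambda _ fun c => measurable_pi_lambda _ fun e => ?_
  unfold feedback
  split_ifs
  · refine Measurable.add (by fun_prop) (Finset.measurable_sum _ fun u _ => ?_)
    exact measurable_from_top.comp ((measurable_bitAt pick D c u).comp hf)
  · exact measurable_const

theorem measurable_partialSums (pick : ChoiceRule P) (D : Fin P.n → Valuation P) :
    Measurable fun ω => partialSums pick D ω := by
  unfold partialSums
  generalize P.horizon + 1 = m
  induction m with
  | zero => exact measurable_const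
  | succ m ih =>
    simp only [Function.iterate_succ_apply']
    exact measurable_feedback pick D ih

theorem measurableFibers_noiseShift (pick : ChoiceRule P) (D D' : Fin P.n → Valuation P) :
    MeasurableFibers fun s : Noise P => noiseShift pick D D' s := by
  refine .pi fun c => .pi fun e => Measurable.measurableFibers ?_
  unfold noiseShift
  split_ifs
  · refine Finset.measurable_sum _ fun u _ => Measurable.sub ?_ ?_
    · exact measurable_from_top.comp (measurable_bitAt pick D c u)
    · exact measurable_from_top.comp (measurable_bitAt pick D' c u)
  · exact measurable_const

end PMatch
end

noncomputable section

/-! ### Translations of Laplace noise -/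

/-- The domination holds on boxes, hence for the outer measures that boxes generate. -/
theorem MeasureTheory.Measure.pi_le_prod_smul_pi {ι : Type*} [Fintype ι] {X : ι → Type*}
    [∀ i, MeasurableSpace (X i)] {μ ν : ∀ i, Measure (X i)} {c : ι → ENNReal}
    (hc : ∀ i, c i ≠ ⊤) (h : ∀ i, μ i ≤ c i • ν i) :
    Measure.pi μ ≤ (∏ i, c i) • Measure.pi ν := by
  have hprod : ∏ i, c i ≠ ⊤ := ENNReal.prod_ne_top fun i _ => hc i
  have houter : OuterMeasure.pi (fun i => (μ i).toOuterMeasure) ≤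
      (∏ i, c i) • OuterMeasure.pi fun i => (ν i).toOuterMeasure := by
    unfold OuterMeasure.pi
    rw [OuterMeasure.smul_boundedBy hprod, OuterMeasure.le_boundedBy]
    intro A
    refine (OuterMeasure.boundedBy_le A).trans ?_
    simp only [piPremeasure, Pi.smul_apply, smul_eq_mul]
    rw [← Finset.prod_mul_distrib]
    exact Finset.prod_le_prod' fun i _ => h i _
  refine Measure.le_iff.2 fun A hA => ?_
  rw [Measure.smul_apply, Measure.pi, Measure.pi, toMeasure_apply _ _ hA, toMeasure_apply _ _ hA]
  exact houter A

/-- The triangle inequality bounds the ratio of the densities at `x` and `x + δ`. -/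
theorem laplaceMeasure_le_map_sub {b : ℝ} (hb : 0 < b) (δ : ℝ) :
    laplaceMeasure b ≤
      ENNReal.ofReal (Real.exp (|δ| / b)) • (laplaceMeasure b).map fun x => x - δ := by
  set f : ℝ → ENNReal := fun x => ENNReal.ofReal (Real.exp (-|x| / b) / (2 * b)) with hf
  have hfm : Measurable f := by fun_prop
  have hpoint : ∀ x, f x ≤ ENNReal.ofReal (Real.exp (|δ| / b)) * f (x + δ) := by
    intro x
    rw [hf, ← ENNReal.ofReal_mul (Real.exp_pos _).le]
    refine ENNReal.ofReal_le_ofReal ?_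
    rw [← mul_div_assoc, ← Real.exp_add]
    gcongr
    rw [← add_div]
    gcongr
    linarith [abs_add_le x δ]
  refine Measure.le_iff.2 fun A hA => ?_
  have hsub : Measurable fun x : ℝ => x - δ := by fun_prop
  rw [Measure.smul_apply, Measure.map_apply hsub hA, laplaceMeasure,
    withDensity_apply _ hA, withDensity_apply _ (hsub hA), smul_eq_mul]
  have htrans : ∫⁻ x in (fun x => x - δ) ⁻¹' A, f x = ∫⁻ x in A, f (x + δ) := by
    rw [← lintegral_indicator (hsub hA), ← lintegral_indicator hA,
      ← lintegral_sub_right_eq_self (A.indicator fun x => f (x + δ)) δ]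
    refine lintegral_congr fun x => ?_
    simp only [Set.indicator, sub_add_cancel]
    rfl
  rw [htrans, ← lintegral_const_mul _ (by fun_prop)]
  exact lintegral_mono hpoint

instance (b : ℝ) : SigmaFinite (laplaceMeasure b) :=
  inferInstanceAs (SigmaFinite (volume.withDensity _))

theorem MeasureTheory.Measure.pi_le_map_sub {ι X : Type*} [Fintype ι] [AddGroup X]
    [MeasurableSpace X] [MeasurableAdd X] {μ : Measure X} [SigmaFinite μ] {c : ι → ENNReal}
    (hc : ∀ i, c i ≠ ⊤) {δ : ι → X} (h : ∀ i, μ ≤ c i • μ.map fun x => x - δ i) :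
    Measure.pi (fun _ : ι => μ) ≤
      (∏ i, c i) • (Measure.pi fun _ : ι => μ).map fun x => x - δ := by
  have hmeas : ∀ i, Measurable fun x => x - δ i := fun i => by
    simpa only [sub_eq_add_neg] using measurable_add_const (-δ i)
  have : ∀ i, SigmaFinite (μ.map fun x => x - δ i) := fun i => by
    have := (MeasurableEquiv.addRight (-δ i)).sigmaFinite_map (μ := μ)
    simpa [sub_eq_add_neg] using this
  have hmap := Measure.pi_map_pi (μ := fun _ : ι => μ) (f := fun i x => x - δ i)
    fun i => (hmeas i).aemeasurable
  change _ ≤ _ • (Measure.pi fun _ : ι => μ).map fun x i => x i - δ i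
  rw [hmap]
  exact Measure.pi_le_prod_smul_pi hc h

/-- If the law of `f` on every part `{k = d}` is dominated by the law of `f'` on this part, then it
is dominated altogether. -/
theorem measure_le_of_forall_fiber {Ω X I : Type*} [MeasurableSpace Ω] [Countable I]
    {μ : Measure Ω} {C : ENNReal} {f f' : Ω → X} {k : X → I}
    (hk : MeasurableFibers fun ω => k (f' ω)) {A : Set X}
    (h : ∀ d, μ {ω | f ω ∈ A ∧ k (f ω) = d} ≤ C * μ {ω | f' ω ∈ A ∧ k (f' ω) = d}) :
    μ {ω | f ω ∈ A} ≤ C * μ {ω | f' ω ∈ A} := by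
  have hcover : {ω | f ω ∈ A} = ⋃ d, {ω | f ω ∈ A ∧ k (f ω) = d} := by
    ext ω
    simp
  have hdisj : Pairwise (Function.onFun Disjoint fun d => {ω | k (f' ω) = d}) := by
    intro d d' hd
    refine Set.disjoint_left.2 fun ω h h' => hd ?_
    exact (h : k (f' ω) = d).symm.trans h'
  have hsum : ∑' d, μ {ω | f' ω ∈ A ∧ k (f' ω) = d} = μ {ω | f' ω ∈ A} := by
    -- The event is an arbitrary set. Restricting `μ` to it leaves only the measurable fibers to be
    -- added up.
    have h₁ := measure_iUnion (μ := μ.restrict {ω | f' ω ∈ A}) hdisj hk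
    have h₂ : ⋃ d, {ω | k (f' ω) = d} = Set.univ := by
      ext ω
      simp
    rw [h₂, Measure.restrict_apply_univ] at h₁
    rw [h₁]
    refine tsum_congr fun d => ?_
    rw [Measure.restrict_apply (hk d), Set.inter_comm]
    rfl
  rw [hcover]
  calc _ ≤ ∑' d, μ {ω | f ω ∈ A ∧ k (f ω) = d} := measure_iUnion_le _
    _ ≤ ∑' d, C * μ {ω | f' ω ∈ A ∧ k (f' ω) = d} := ENNReal.tsum_le_tsum h
    _ = _ := by rw [ENNReal.tsum_mul_left, hsum]

/-! ### Privacy of the noisy partial sums -/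

namespace PMatch

variable {P : Params}

theorem noiseLaw_le_map_sub (hb : 0 < Real.logb 2 P.horizon / P.ε') (δ : Noise P) :
    noiseLaw P ≤
      ENNReal.ofReal (Real.exp ((∑ c, ∑ e, |δ c e|) / (Real.logb 2 P.horizon / P.ε'))) •
        (noiseLaw P).map fun ω => ω - δ := by
  set b := Real.logb 2 P.horizon / P.ε'
  have hprod : ENNReal.ofReal (Real.exp ((∑ c, ∑ e, |δ c e|) / b)) =
      ∏ c, ∏ e, ENNReal.ofReal (Real.exp (|δ c e| / b)) := by
    simp only [Finset.sum_div, Real.exp_sum]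
    rw [ENNReal.ofReal_prod_of_nonneg fun _ _ => by positivity]
    refine Finset.prod_congr rfl fun c _ => ?_
    rw [ENNReal.ofReal_prod_of_nonneg fun _ _ => by positivity]
  rw [hprod]
  exact Measure.pi_le_map_sub (fun _ => ENNReal.prod_ne_top fun _ _ => ENNReal.ofReal_ne_top)
    fun c => Measure.pi_le_map_sub (fun _ => ENNReal.ofReal_ne_top)
      fun e => laplaceMeasure_le_map_sub hb (δ c e)

/-- The old partial sums solve the fixed point equation for `D'` with the shifted coins, and the
solution is unique. -/
theorem partialSums_add_noiseShift (pick : ChoiceRule P) (D D' : Fin P.n → Valuation P)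
    (ω : Noise P) :
    partialSums pick D'
      (ω + fun c e => (noiseShift pick D D' (partialSums pick D ω) c e : ℝ)) =
        partialSums pick D ω := by
  refine (eq_partialSums_of_feedback_eq ?_).symm
  conv_rhs => rw [← feedback_partialSums]
  funext c e
  by_cases h : IsReleased P c e
  · simp [feedback, noiseShift, h, Finset.sum_sub_distrib]
    ring
  · simp [feedback, h]

theorem eight_le_T (hα : 0 < P.α) (hα1 : P.α ≤ 1) (hρ : 0 < P.ρ) (hρ1 : P.ρ ≤ 1) : 8 ≤ P.T := by
  have h : (8 : ℝ) ≤ 8 / (P.α * P.ρ) := by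
    rw [le_div_iff₀ (by positivity)]
    nlinarith [mul_le_one₀ hα1 hρ.le hρ1]
  have := h.trans (Nat.le_ceil _)
  exact_mod_cast this

/-- The noisy partial sums are differentially private. -/
theorem noiseLaw_partialSums_le (hT : 8 ≤ P.T) (hε : 0 < P.ε) (pick : ChoiceRule P) {i : Fin P.n}
    {D D' : Fin P.n → Valuation P} (h : AreNeighborsAt i D D') (A : Set (Noise P)) :
    noiseLaw P {ω | partialSums pick D ω ∈ A} ≤
      ENNReal.ofReal (Real.exp P.ε) * noiseLaw P {ω | partialSums pick D' ω ∈ A} := by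
  have hn : 0 < P.n := i.pos
  have hN : 2 ≤ P.horizon := by
    unfold Params.horizon
    nlinarith
  have hlog : 0 < Real.logb 2 P.horizon :=
    Real.logb_pos (by norm_num) (by exact_mod_cast (by omega : 1 < P.horizon))
  have hTpos : (0 : ℝ) < P.T := by exact_mod_cast (by omega : 0 < P.T)
  have hε' : 0 < P.ε' := by unfold Params.ε'; positivity
  refine measure_le_of_forall_fiber (k := noiseShift pick D D')
    (fun d => measurable_partialSums pick D' (measurableFibers_noiseShift pick D D' d))
    fun d => ?_
  -- The sensitivity bound applies to `d` only if some coins `ω₀` attain it; otherwise there is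
  -- nothing to show.
  rcases Set.eq_empty_or_nonempty
    {ω | partialSums pick D ω ∈ A ∧ noiseShift pick D D' (partialSums pick D ω) = d}
    with hempty | ⟨ω₀, -, hω₀⟩
  · rw [hempty]
    simp
  have hbound : (∑ c, ∑ e, |(d c e : ℝ)|) / (Real.logb 2 P.horizon / P.ε') ≤ P.ε := by
    have h₁ := sum_natAbs_noiseShift_le (pick := pick) (s := partialSums pick D ω₀) hT h
    rw [hω₀] at h₁
    have h₂ : (∑ c, ∑ e, |(d c e : ℝ)|) ≤ 2 * P.T * Nat.log 2 P.horizon := by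
      have : (∑ c, ∑ e, |(d c e : ℝ)|) = ((∑ c, ∑ e, (d c e).natAbs : ℕ) : ℝ) := by
        push_cast
        simp [Nat.cast_natAbs]
      rw [this]
      exact_mod_cast h₁
    have h₃ : (Nat.log 2 P.horizon : ℝ) ≤ Real.logb 2 P.horizon := by
      exact_mod_cast Real.natLog_le_logb P.horizon 2
    have h₄ : 2 * P.T * P.ε' = P.ε := by
      unfold Params.ε'
      field_simp
    rw [div_le_iff₀ (by positivity), ← h₄]
    calc _ ≤ 2 * (P.T : ℝ) * Nat.log 2 P.horizon := h₂
      _ ≤ 2 * P.T * Real.logb 2 P.horizon := by gcongr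
      _ = _ := by field_simp
  set δ : Noise P := fun c e => (d c e : ℝ)
  refine (noiseLaw_le_map_sub (by positivity) δ _).trans ?_
  rw [Measure.smul_apply, smul_eq_mul]
  refine mul_le_mul' (ENNReal.ofReal_le_ofReal (Real.exp_le_exp.2 hbound)) ?_
  have hequiv := (MeasurableEquiv.addRight (-δ)).map_apply (μ := noiseLaw P)
    {ω | partialSums pick D ω ∈ A ∧ noiseShift pick D D' (partialSums pick D ω) = d}
  simp only [MeasurableEquiv.coe_addRight, ← sub_eq_add_neg] at hequiv
  rw [hequiv]
  -- The translation sends the fiber for `D` into the fiber for `D'` over the same `d`, since the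
  -- partial sums are unchanged.
  refine measure_mono fun ω hω => ?_
  obtain ⟨hA, hd⟩ := hω
  have key := partialSums_add_noiseShift pick D D' (ω - δ)
  rw [hd, sub_add_cancel] at key
  exact ⟨by rwa [key], by rwa [key]⟩

/-- A quantity that is determined by the noisy partial sums is differentially private. -/
theorem noiseLaw_mem_le {R : Type*} (hT : 8 ≤ P.T) (hε : 0 < P.ε) (pick : ChoiceRule P)
    {i : Fin P.n} {D D' : Fin P.n → Valuation P} (h : AreNeighborsAt i D D')
    {f f' : Noise P → R}
    (hf : ∀ ω ω', partialSums pick D ω = partialSums pick D' ω' → f ω = f' ω') (S : Set R) :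
    noiseLaw P {ω | f ω ∈ S} ≤
      ENNReal.ofReal (Real.exp P.ε) * noiseLaw P {ω | f' ω ∈ S} := by
  calc noiseLaw P {ω | f ω ∈ S}
      -- The image of the event need not be measurable; the bound for partial sums holds for
      -- arbitrary sets.
      ≤ noiseLaw P {ω | partialSums pick D ω ∈ partialSums pick D '' {ω | f ω ∈ S}} :=
        measure_mono fun ω hω => ⟨ω, hω, rfl⟩
    _ ≤ ENNReal.ofReal (Real.exp P.ε) *
          noiseLaw P {ω | partialSums pick D' ω ∈ partialSums pick D '' {ω | f ω ∈ S}} :=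
        noiseLaw_partialSums_le hT hε pick h _
    _ ≤ _ := by
      refine mul_le_mul_right (measure_mono ?_) _
      rintro ω ⟨ω₀, hω₀, heq⟩
      change f' ω ∈ S
      rw [← hf ω₀ ω heq]
      exact hω₀

end PMatch
end

theorem mainTheorem2 (P : PMatch.Params)
    (hα : 0 < P.α) (hα1 : P.α ≤ 1) (hρ : 0 < P.ρ) (hρ1 : P.ρ ≤ 1) (hε : 0 < P.ε) (hγ : 0 < P.γ)
    (pick : PMatch.ChoiceRule P) (hpick : pick.IsArgmax) :
    IsJointDifferentiallyPrivate P.ε (PMatch.noiseLaw P) (PMatch.output pick) ∧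
      IsDifferentiallyPrivate P.ε (PMatch.noiseLaw P) (PMatch.trajectory pick) := by
  have hT := PMatch.eight_le_T hα hα1 hρ hρ1
  constructor
  · intro i D D' h S _
    refine PMatch.noiseLaw_mem_le hT hε pick h
      (f := fun ω (j : {j : Fin P.n // j ≠ i}) => PMatch.output pick D ω j)
      (f' := fun ω (j : {j : Fin P.n // j ≠ i}) => PMatch.output pick D' ω j)
      (fun ω ω' heq => ?_) S
    funext j
    exact PMatch.output_eq (by omega) heq (h j j.2)
  · intro i D D' h S _
    exact PMatch.noiseLaw_mem_le hT hε pick h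
      (fun ω ω' heq => PMatch.trajectory_eq (by omega) heq) S
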